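/- Let $\Lambda=\mathbb{R}[t^{\pm1}]$ with the involution $\overline{p(t)}=p(t^{-1})$, extended to its quotient field $\mathbb{R}(t)$ and to $\mathbb{R}(t)/\Lambda$. A *Blanchfield form* over $\Lambda$ is a map $\lambda\colon H\times H\to\mathbb{R}(t)/\Lambda$, where $H$ is a finitely generated torsion $\Lambda$-module, which is linear in the second variable, satisfies $\lambda(a,b)=\overline{\lambda(b,a)}$ (so it is conjugate-linear in the first variable), and is non-singular, i.e. $a\mapsto\lambda(a,\cdot)$ is a bijection $H\to\operatorname{Hom}_\Lambda(H,\mathbb{R}(t)/\Lambda)$. Isometry of forms is denoted by $\cong$. An $n\times n$ matrix $A$ over $\Lambda$ ($n\ge 0$) is *hermitian* if $\overline{A}^{\,t}=A$. For hermitian $A$ with $\det A\neq 0$ let $\lambda(A)$ be the Blanchfield form on $\Lambda^n/A\Lambda^n$ given by $(a,b)\mapsto \overline{a}^{\,t}A^{-1}b$; we say that $A$ *represents* $\lambda$ if $\lambda(A)\cong\lambda$. Let $n_{\mathbb{R}}(\lambda)\in\{0,1,2,\dots\}\cup\{\infty\}$ be the minimal size of a hermitian matrix $A$ over $\Lambda$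 which represents $\lambda$ and for which the real symmetric matrix $A(1)$ is diagonalizable by congruence over $\mathbb{R}$ (a condition that always holds), with $n_{\mathbb{R}}(\lambda)=\infty$ if there is no such $A$. For a hermitian matrix $A$ over $\Lambda$ put $\sigma_A(z)=\operatorname{sign}(A(z))-\operatorname{sign}(A(1))$ for $z\in S^1$, put $\eta_A(z)=\dim_{\mathbb{C}}\ker A(z)$ for $z\in\mathbb{C}\setminus\{0\}$, and $$\mu(A)=\tfrac12\Big(\max_{z\in S^1}\{\eta_A(z)+\sigma_A(z)\}+\max_{z\in S^1}\{\eta_A(z)-\sigma_A(z)\}\Big),\qquad \eta(A)=\max_{z\in\mathbb{C}\setminus\{0\}}\eta_A(z).$$ **Theorem.** (1) Let $\lambda\colon H\times H\to\mathbb{R}(t)/\Lambda$ be a Blanchfield form such that multiplication by $t+1$ and multiplication by $t-1$ are isomorphisms of $H$. Then $\lambda$ is represented by some hermitian matrix $B$ over $\Lambda$ with $\det B\ne 0$; the numbers $\mu(\lambda):=\mu(B)$ and $\eta(\lambda):=\eta(B)$ do not depend on the choice of the representing matrix $B$; and $n_{\mathbb{R}}(\lambda)$ is finite with $$n_{\mathbb{R}}(\lambda)=\max\{\mu(\lambda),\eta(\lambda)\}.$$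 (2) Equivalently, for every hermitian matrix $B$ over $\Lambda$ with $\det B(1)\neq0$ and $\det B(-1)\ne0$, the number $n_{\mathbb{R}}(\lambda(B))$ is finite and $$n_{\mathbb{R}}(\lambda(B))=\max\{\mu(B),\eta(B)\}.$$ -/

import Mathlib

namespace Blanchfield

open Matrix

noncomputable section

/-- The ring `ℝ[t, t⁻¹]`. -/
abbrev Lam : Type := LaurentPolynomial ℝ

/-- The quotient field `ℝ(t)` of `ℝ[t, t⁻¹]`. -/
abbrev Om : Type := FractionRing Lam

/-- The `ℝ[t, t⁻¹]`-module `ℝ(t) / ℝ[t, t⁻¹]`. -/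
abbrev OmLam : Type := Om ⧸ LinearMap.range (Algebra.linearMap Lam Om)

/-- The involution `p(t) ↦ p(t⁻¹)` of `ℝ[t, t⁻¹]`. -/
abbrev conj : Lam →+* Lam := (LaurentPolynomial.invert (R := ℝ)).toRingEquiv.toRingHom

theorem conj_conj (p : Lam) : conj (conj p) = p :=
  LaurentPolynomial.involutive_invert p

/-- The extension of the involution to `ℝ(t)`, as a semilinear map. -/
def conjOm : Om →ₛₗ[conj] Om where
  toFun := IsFractionRing.ringEquivOfRingEquiv (K := Om) (L := Om)
    (LaurentPolynomial.invert (R := ℝ)).toRingEquiv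
  map_add' := map_add _
  map_smul' p x := by
    rw [Algebra.smul_def, map_mul, IsFractionRing.ringEquivOfRingEquiv_algebraMap,
      Algebra.smul_def]
    rfl

theorem conjOm_algebraMap (p : Lam) :
    conjOm (algebraMap Lam Om p) = algebraMap Lam Om (conj p) :=
  IsFractionRing.ringEquivOfRingEquiv_algebraMap _ p

/-- The induced involution of `ℝ(t) / ℝ[t, t⁻¹]`. -/
def conjOmLam : OmLam →ₛₗ[conj] OmLam :=
  Submodule.mapQ _ _ conjOm (by
    rintro _ ⟨p, rfl⟩
    exact ⟨conj p, (conjOm_algebraMap p).symm⟩)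

/-- Maps `H × H → ℝ(t) / ℝ[t, t⁻¹]` which are linear in the second and conjugate-linear in the
first variable. -/
abbrev Form (H : Type*) [AddCommGroup H] [Module Lam H] : Type _ :=
  H →ₛₗ[conj] H →ₗ[Lam] OmLam

/-- A Blanchfield form over `ℝ[t, t⁻¹]`: a hermitian non-singular form on a finitely generated
torsion module. -/
structure IsBlanchfield {H : Type*} [AddCommGroup H] [Module Lam H] (lam : Form H) : Prop where
  finite : Module.Finite Lam H
  torsion : Module.IsTorsion Lam H
  hermitian : ∀ a b : H, lam a b = conjOmLam (lam b a)
  nonsingular : Function.Bijective (fun a : H => (lam a : H →ₗ[Lam] OmLam))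

/-- Isometry of forms. -/
def Isometric {H H' : Type*} [AddCommGroup H] [Module Lam H] [AddCommGroup H'] [Module Lam H']
    (lam : Form H) (lam' : Form H') : Prop :=
  ∃ e : H ≃ₗ[Lam] H', ∀ a b : H, lam' (e a) (e b) = lam a b

/-- Hermitian matrices over `ℝ[t, t⁻¹]`: the conjugate transpose of `A` equals `A`. -/
def IsHerm {n : ℕ} (A : Matrix (Fin n) (Fin n) Lam) : Prop :=
  (A.map conj)ᵀ = A

/-- The module `ℝ[t, t⁻¹]ⁿ / A ℝ[t, t⁻¹]ⁿ`. -/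
abbrev Coker {n : ℕ} (A : Matrix (Fin n) (Fin n) Lam) : Type :=
  (Fin n → Lam) ⧸ LinearMap.range A.mulVecLin

/-- The element `āᵗ A⁻¹ b` of `ℝ(t)`. -/
def pairing {n : ℕ} (A : Matrix (Fin n) (Fin n) Lam) (a b : Fin n → Lam) : Om :=
  (fun i => algebraMap Lam Om (conj (a i))) ⬝ᵥ
    ((A.map (algebraMap Lam Om))⁻¹ *ᵥ fun i => algebraMap Lam Om (b i))

theorem isUnit_det_map {n : ℕ} (A : Matrix (Fin n) (Fin n) Lam) (hd : A.det ≠ 0) :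
    IsUnit (A.map (algebraMap Lam Om)).det := by
  rw [isUnit_iff_ne_zero, ← RingHom.mapMatrix_apply, ← RingHom.map_det]
  exact fun h => hd (IsFractionRing.injective Lam Om (by rw [h, map_zero]))

theorem pairing_mulVec_right {n : ℕ} (A : Matrix (Fin n) (Fin n) Lam) (hd : A.det ≠ 0)
    (a c : Fin n → Lam) :
    pairing A a (A *ᵥ c) = algebraMap Lam Om ((fun i => conj (a i)) ⬝ᵥ c) := by
  have h : (fun i => algebraMap Lam Om ((A *ᵥ c) i)) =
      A.map (algebraMap Lam Om) *ᵥ fun i => algebraMap Lam Om (c i) := by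
    funext i
    exact RingHom.map_mulVec _ A c i
  rw [pairing, h, mulVec_mulVec, nonsing_inv_mul _ (isUnit_det_map A hd), one_mulVec]
  simp [dotProduct]

theorem pairing_mulVec_left {n : ℕ} (A : Matrix (Fin n) (Fin n) Lam) (hA : IsHerm A)
    (hd : A.det ≠ 0) (c b : Fin n → Lam) :
    pairing A (A *ᵥ c) b = algebraMap Lam Om ((fun i => conj (c i)) ⬝ᵥ b) := by
  have h : (fun i => algebraMap Lam Om (conj ((A *ᵥ c) i))) =
      (fun i => algebraMap Lam Om (conj (c i))) ᵥ* A.map (algebraMap Lam Om) := by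
    funext i
    rw [RingHom.map_mulVec, RingHom.map_mulVec]
    simp only [mulVec, vecMul, dotProduct, Function.comp_apply, map_apply]
    refine Finset.sum_congr rfl fun j _ => ?_
    rw [mul_comm, ← show conj (A i j) = A j i from congrFun (congrFun hA j) i]
  rw [pairing, h, dotProduct_mulVec, vecMul_vecMul, mul_nonsing_inv _ (isUnit_det_map A hd),
    vecMul_one]
  simp [dotProduct]

/-- The map `(a, b) ↦ āᵗ A⁻¹ b` on `ℝ[t, t⁻¹]ⁿ`, with values in `ℝ(t) / ℝ[t, t⁻¹]`. -/
def preForm {n : ℕ} (A : Matrix (Fin n) (Fin n) Lam) : Form (Fin n → Lam) :=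
  LinearMap.mk₂'ₛₗ conj (RingHom.id Lam) (fun a b => Submodule.Quotient.mk (pairing A a b))
    (fun a a' b => by
      rw [← Submodule.Quotient.mk_add]; congr 1
      simp only [pairing, ← add_dotProduct]; congr 1; funext i; simp)
    (fun p a b => by
      rw [← Submodule.Quotient.mk_smul]; congr 1
      simp only [pairing, ← smul_dotProduct]; congr 1; funext i; simp [Algebra.smul_def])
    (fun a b b' => by
      rw [← Submodule.Quotient.mk_add]; congr 1
      simp only [pairing, ← dotProduct_add, ← mulVec_add]; congr 2; funext i; simp)
    (fun p a b => by
      rw [← Submodule.Quotient.mk_smul]; congr 1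
      simp only [pairing, RingHom.id_apply, ← dotProduct_smul, ← mulVec_smul]
      congr 2; funext i; simp [Algebra.smul_def])

theorem preForm_apply {n : ℕ} (A : Matrix (Fin n) (Fin n) Lam) (a b : Fin n → Lam) :
    preForm A a b = Submodule.Quotient.mk (pairing A a b) := rfl

/-- The form `λ(A)` on `ℝ[t, t⁻¹]ⁿ / A ℝ[t, t⁻¹]ⁿ`, given by `(a, b) ↦ āᵗ A⁻¹ b`. -/
def formOf {n : ℕ} (A : Matrix (Fin n) (Fin n) Lam) (hA : IsHerm A) (hd : A.det ≠ 0) :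
    Form (Coker A) :=
  Submodule.liftQ _
    { toFun := fun a => Submodule.liftQ _ (preForm A a) (by
        rintro _ ⟨c, rfl⟩
        rw [LinearMap.mem_ker, mulVecLin_apply, preForm_apply, Submodule.Quotient.mk_eq_zero,
          pairing_mulVec_right A hd]
        exact ⟨_, rfl⟩)
      map_add' := fun a a' => by
        refine Submodule.linearMap_qext _ (LinearMap.ext fun b => ?_)
        simp
      map_smul' := fun p a => by
        refine Submodule.linearMap_qext _ (LinearMap.ext fun b => ?_)
        exact LinearMap.congr_fun ((preForm A).map_smulₛₗ p a) b }
    (by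
      rintro _ ⟨c, rfl⟩
      rw [LinearMap.mem_ker]
      refine Submodule.linearMap_qext _ (LinearMap.ext fun b => ?_)
      change (Submodule.Quotient.mk (pairing A (A *ᵥ c) b) : OmLam) = 0
      rw [Submodule.Quotient.mk_eq_zero, pairing_mulVec_left A hA hd]
      exact ⟨_, rfl⟩)

theorem formOf_mk {n : ℕ} (A : Matrix (Fin n) (Fin n) Lam) (hA : IsHerm A) (hd : A.det ≠ 0)
    (a b : Fin n → Lam) :
    formOf A hA hd (Submodule.Quotient.mk a) (Submodule.Quotient.mk b) =
      Submodule.Quotient.mk (pairing A a b) := rfl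

/-- The hermitian matrix `A`, with non-zero determinant, represents the form `lam`. -/
def Represents {n : ℕ} (A : Matrix (Fin n) (Fin n) Lam) {H : Type*} [AddCommGroup H]
    [Module Lam H] (lam : Form H) : Prop :=
  ∃ (hA : IsHerm A) (hd : A.det ≠ 0), Isometric (formOf A hA hd) lam

/-- The real matrix `A(1)`. -/
def evalOne {n : ℕ} (A : Matrix (Fin n) (Fin n) Lam) : Matrix (Fin n) (Fin n) ℝ :=
  A.map (LaurentPolynomial.eval₂ (RingHom.id ℝ) 1)

/-- A real symmetric matrix, viewed as a symmetric bilinear form, is diagonalizable. -/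
def Diagonalizable {n : ℕ} (S : Matrix (Fin n) (Fin n) ℝ) : Prop :=
  ∃ P : Matrix (Fin n) (Fin n) ℝ, IsUnit P.det ∧ (P * S * Pᵀ).IsDiag

/-- The Blanchfield form dimension `n_ℝ(lam)`: the minimal size of a hermitian matrix `A`
representing `lam` such that `A(1)` is diagonalizable, and `∞` if there is none. -/
def nR {H : Type*} [AddCommGroup H] [Module Lam H] (lam : Form H) : ℕ∞ :=
  sInf {N : ℕ∞ | ∃ (n : ℕ) (A : Matrix (Fin n) (Fin n) Lam),
    N = n ∧ Represents A lam ∧ Diagonalizable (evalOne A)}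

/-- The complex matrix `A(z)`, for a non-zero complex number `z`. -/
def evalAt {n : ℕ} (A : Matrix (Fin n) (Fin n) Lam) (z : ℂˣ) : Matrix (Fin n) (Fin n) ℂ :=
  A.map (LaurentPolynomial.eval₂ (algebraMap ℝ ℂ) z)

/-- The positive index of inertia of a hermitian matrix: the maximal dimension of a subspace on
which the hermitian form `v ↦ v* M v` is positive definite. -/
def posIndex {n : ℕ} (M : Matrix (Fin n) (Fin n) ℂ) : ℕ :=
  sSup {r : ℕ | ∃ V : Submodule ℂ (Fin n → ℂ), Module.finrank ℂ V = r ∧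
    ∀ v ∈ V, v ≠ 0 → 0 < (star v ⬝ᵥ (M *ᵥ v)).re}

/-- The signature of a hermitian matrix. -/
def sign {n : ℕ} (M : Matrix (Fin n) (Fin n) ℂ) : ℤ :=
  (posIndex M : ℤ) - (posIndex (-M) : ℤ)

/-- `σ_A(z) = sign(A(z)) - sign(A(1))`, for `z` on the unit circle. -/
def sig {n : ℕ} (A : Matrix (Fin n) (Fin n) Lam) (z : Circle) : ℤ :=
  sign (evalAt A (Circle.toUnits z)) - sign (evalAt A 1)

/-- `η_A(z)`, the nullity of `A(z)`. -/
def nul {n : ℕ} (A : Matrix (Fin n) (Fin n) Lam) (z : ℂˣ) : ℕ :=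
  Module.finrank ℂ (LinearMap.ker (evalAt A z).mulVecLin)

/-- `μ(A)`. The suprema are taken over non-empty bounded sets of integers, so they are maxima. -/
def muMat {n : ℕ} (A : Matrix (Fin n) (Fin n) Lam) : ℚ :=
  (((⨆ z : Circle, ((nul A (Circle.toUnits z) : ℤ) + sig A z) : ℤ) : ℚ) +
    ((⨆ z : Circle, ((nul A (Circle.toUnits z) : ℤ) - sig A z) : ℤ) : ℚ)) / 2

/-- `η(A)`, the maximal nullity of `A(z)` for `z ∈ ℂ ∖ {0}`. -/
def etaMat {n : ℕ} (A : Matrix (Fin n) (Fin n) Lam) : ℕ :=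
  ⨆ z : ℂˣ, nul A z

open Classical in
/-- `μ(lam) = μ(B)` for a matrix `B` representing `lam` (and `0` if there is none). -/
def mu {H : Type*} [AddCommGroup H] [Module Lam H] (lam : Form H) : ℚ :=
  if h : ∃ B : (n : ℕ) × Matrix (Fin n) (Fin n) Lam, Represents B.2 lam then
    muMat h.choose.2 else 0

open Classical in
/-- `η(lam) = η(B)` for a matrix `B` representing `lam` (and `0` if there is none). -/
def eta {H : Type*} [AddCommGroup H] [Module Lam H] (lam : Form H) : ℕ :=
  if h : ∃ B : (n : ℕ) × Matrix (Fin n) (Fin n) Lam, Represents B.2 lam then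
    etaMat h.choose.2 else 0

theorem det_ne_zero_of_det_evalAt_ne_zero {n : ℕ} {A : Matrix (Fin n) (Fin n) Lam} {z : ℂˣ}
    (h : (evalAt A z).det ≠ 0) : A.det ≠ 0 := by
  intro h0
  apply h
  rw [evalAt, ← RingHom.mapMatrix_apply, ← RingHom.map_det, h0, map_zero]

end

end Blanchfield

namespace Blanchfield

open Matrix

noncomputable section

/-! ### Hermitian matrices over the complex numbers -/

/-! Symmetric Laurent polynomials are the real polynomials in X = t + t⁻¹. Under X the unit circle
becomes the interval [-2, 2], with t = 1 over 2 and t = -1 over -2.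

Invariance. If A and B represent the same form, there is a unimodular hermitian matrix W over Λ with
B as a diagonal block and -A as the complementary diagonal block of W⁻¹
(`Represents.exists_complementary`). Hence A(z) and B(z) have equal nullity, and on the circle sign
B(z) - sign A(z) = sign W(z). This is constant because W(z) is never singular, so σ_A = σ_B.

Lower bound. A hermitian A of size n satisfies η_A(z) ± sign A(z) ≤ n. Adding the two inequalities,
at possibly different points, cancels sign A(1) and gives μ ≤ n; η ≤ n is clear.

Upper bound. Without (t² - 1)-torsion the form is an orthogonal sum of cyclic forms 1/d, with d a
scaled power of an irreducible polynomial in X (`exists_diagGen_primary`). By the Fejér-Riesz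
theorem, orthogonal cyclic forms 1/a and 1/b of coprime orders merge into 1/(εab) once εb > 0 at the
zeros of a in [-2, 2] and εa > 0 at those of b (`IsNondeg.exists_absorb`). Put N = max(μ, η) and 2q
= max(η + σ). Start from N zero generators of constant orders ±1, with q minus signs, and merge the
primary summands into them: first those with d > 0 on [-2, 2], then the powers of X - c by
decreasing c. The bound η ≤ N leaves a slot of coprime order. If no slot had the right sign at c,
then η + σ or η - σ would be too large there (`Sweep.exists_sign`). In the end N orthogonal
generators remain, so the representing matrix is diagonal, and so is its value at 1. -/

theorem star_sumElim {ι κ : Type*} (v : ι → ℂ) (w : κ → ℂ) :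
    star (Sum.elim v w) = Sum.elim (star v) (star w) := by
  ext i; cases i <;> rfl

section Inertia

variable {ι κ : Type*} [Fintype ι] [Fintype κ]

/-- The value at `v` of the hermitian form of the matrix `M`. -/
def qf (M : Matrix ι ι ℂ) (v : ι → ℂ) : ℝ := (star v ⬝ᵥ (M *ᵥ v)).re

/-- The hermitian form of `M` is positive definite on `V`. -/
def PosOn (M : Matrix ι ι ℂ) (V : Submodule ℂ (ι → ℂ)) : Prop := ∀ v ∈ V, v ≠ 0 → 0 < qf M v

/-- The positive index of inertia of a matrix with arbitrary finite index type. -/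
def posDim (M : Matrix ι ι ℂ) : ℕ :=
  sSup {r : ℕ | ∃ V : Submodule ℂ (ι → ℂ), Module.finrank ℂ V = r ∧ PosOn M V}

/-- The nullity of a square matrix. -/
def nulDim (M : Matrix ι ι ℂ) : ℕ := Module.finrank ℂ (LinearMap.ker M.mulVecLin)

theorem nulDim_neg (M : Matrix ι ι ℂ) : nulDim (-M) = nulDim M := by
  have h : LinearMap.ker (-M).mulVecLin = LinearMap.ker M.mulVecLin := by
    ext v
    simp
  rw [nulDim, h, nulDim]

theorem qf_zero (M : Matrix ι ι ℂ) : qf M 0 = 0 := by simp [qf]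

theorem qf_neg (M : Matrix ι ι ℂ) (v : ι → ℂ) : qf (-M) v = -qf M v := by
  simp [qf, neg_mulVec]

theorem qf_add_of_orthogonal {M : Matrix ι ι ℂ} (hM : M.IsHermitian) {v w : ι → ℂ}
    (h : star v ⬝ᵥ (M *ᵥ w) = 0) : qf M (v + w) = qf M v + qf M w := by
  have h' : star w ⬝ᵥ (M *ᵥ v) = 0 := by
    have := congrArg star h
    rwa [star_zero, star_dotProduct, star_mulVec, hM.eq, ← dotProduct_mulVec, star_star,
      dotProduct_comm, ← dotProduct_comm] at this
  simp [qf, mulVec_add, dotProduct_add, add_dotProduct, h, h']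

theorem bddAbove_posOn (M : Matrix ι ι ℂ) :
    BddAbove {r : ℕ | ∃ V : Submodule ℂ (ι → ℂ), Module.finrank ℂ V = r ∧ PosOn M V} := by
  refine ⟨Fintype.card ι, ?_⟩
  rintro _ ⟨V, rfl, -⟩
  simpa using Submodule.finrank_le V

theorem PosOn.finrank_le {M : Matrix ι ι ℂ} {V : Submodule ℂ (ι → ℂ)} (h : PosOn M V) :
    Module.finrank ℂ V ≤ posDim M :=
  le_csSup (bddAbove_posOn M) ⟨V, rfl, h⟩

theorem exists_posOn (M : Matrix ι ι ℂ) :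
    ∃ V : Submodule ℂ (ι → ℂ), Module.finrank ℂ V = posDim M ∧ PosOn M V :=
  Nat.sSup_mem (s := {r : ℕ | ∃ V : Submodule ℂ (ι → ℂ), Module.finrank ℂ V = r ∧ PosOn M V})
    ⟨0, ⊥, by simp, fun v hv h0 => absurd ((Submodule.mem_bot ℂ).1 hv) h0⟩ (bddAbove_posOn M)

theorem finrank_add_le_of_disjoint {V W : Submodule ℂ (ι → ℂ)} (h : Disjoint V W) :
    Module.finrank ℂ V + Module.finrank ℂ W ≤ Fintype.card ι := by
  have h1 := Submodule.finrank_sup_add_finrank_inf_eq V W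
  rw [h.eq_bot, finrank_bot] at h1
  have h2 := Submodule.finrank_le (V ⊔ W)
  rw [Module.finrank_fintype_fun_eq_card] at h2
  omega

/-- A subspace on which the form is nonpositive meets a positive definite one only in 0. This is how
`posDim` gets bounded from above. -/
theorem finrank_add_posDim_le {M : Matrix ι ι ℂ} {V : Submodule ℂ (ι → ℂ)}
    (h : ∀ v ∈ V, qf M v ≤ 0) : Module.finrank ℂ V + posDim M ≤ Fintype.card ι := by
  obtain ⟨P, hP, hpos⟩ := exists_posOn M
  rw [← hP]
  refine finrank_add_le_of_disjoint (Submodule.disjoint_def.2 fun v hv hv' => ?_)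
  by_contra h0
  exact absurd (hpos v hv' h0) (not_lt.2 (h v hv))

/-- The vectors supported on a set of coordinates. -/
def coordSub (s : Set ι) : Submodule ℂ (ι → ℂ) where
  carrier := {v | ∀ i, i ∉ s → v i = 0}
  add_mem' h h' i hi := by simp [h i hi, h' i hi]
  zero_mem' _ _ := rfl
  smul_mem' c v h i hi := by simp [h i hi]

theorem finrank_coordSub (s : Set ι) : Module.finrank ℂ (coordSub s) = Nat.card s := by
  classical
  let e : (coordSub s) ≃ₗ[ℂ] (s → ℂ) :=
    { toFun := fun v i => v.1 i
      map_add' := fun _ _ => rfl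
      map_smul' := fun _ _ => rfl
      invFun := fun w => ⟨fun i => if h : i ∈ s then w ⟨i, h⟩ else 0, fun i hi => by simp [hi]⟩
      left_inv := fun v => by
        ext i
        by_cases hi : i ∈ s
        · simp [hi]
        · simp [hi, v.2 i hi]
      right_inv := fun w => by ext i; simp }
  rw [e.finrank_eq, Module.finrank_fintype_fun_eq_card, Nat.card_eq_fintype_card]

theorem qf_diagonal [DecidableEq ι] (d : ι → ℝ) (v : ι → ℂ) :
    qf (diagonal fun i => (d i : ℂ)) v = ∑ i, d i * Complex.normSq (v i) := by
  simp only [qf, mulVec_diagonal, dotProduct, Pi.star_apply, Complex.re_sum]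
  refine Finset.sum_congr rfl fun i _ => ?_
  rw [mul_left_comm, RCLike.star_def, ← Complex.normSq_eq_conj_mul_self]
  simp [← Complex.ofReal_mul]

theorem posOn_coordSub [DecidableEq ι] (d : ι → ℝ) :
    PosOn (diagonal fun i => (d i : ℂ)) (coordSub {i | 0 < d i}) := by
  intro v hv h0
  rw [qf_diagonal]
  obtain ⟨i, hi⟩ := Function.ne_iff.1 h0
  refine Finset.sum_pos' (fun j _ => ?_) ⟨i, Finset.mem_univ i, ?_⟩
  · by_cases hj : 0 < d j
    · exact mul_nonneg hj.le (Complex.normSq_nonneg _)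
    · simp [hv j hj]
  · refine mul_pos ?_ (Complex.normSq_pos.2 hi)
    by_contra hd
    exact hi (hv i hd)

theorem posDim_diagonal [DecidableEq ι] (d : ι → ℝ) :
    posDim (diagonal fun i => (d i : ℂ)) = Nat.card {i | 0 < d i} := by
  refine le_antisymm ?_ ?_
  · have h := finrank_add_posDim_le (M := diagonal fun i => (d i : ℂ))
      (V := coordSub {i | 0 < d i}ᶜ) (fun v hv => by
        rw [qf_diagonal]
        refine Finset.sum_nonpos fun i _ => ?_
        by_cases hi : 0 < d i
        · simp [hv i (by simpa using hi)]
        · exact mul_nonpos_of_nonpos_of_nonneg (not_lt.1 hi) (Complex.normSq_nonneg _))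
    rw [finrank_coordSub, Nat.card_coe_set_eq, Set.ncard_compl, Nat.card_eq_fintype_card] at h
    rw [Nat.card_coe_set_eq]
    have := Set.ncard_le_card {i | 0 < d i}
    rw [Nat.card_eq_fintype_card] at this
    omega
  · rw [← finrank_coordSub]
    exact (posOn_coordSub d).finrank_le

theorem posDim_neg_diagonal [DecidableEq ι] (d : ι → ℝ) :
    posDim (-diagonal fun i => (d i : ℂ)) = Nat.card {i | d i < 0} := by
  have h : (-diagonal fun i => (d i : ℂ)) = diagonal fun i => ((-d i : ℝ) : ℂ) := by
    rw [diagonal_neg]; congr 1; funext i; simp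
  rw [h, posDim_diagonal]
  simp

theorem nulDim_diagonal [DecidableEq ι] (d : ι → ℂ) :
    nulDim (diagonal d) = Nat.card {i | d i = 0} := by
  rw [← finrank_coordSub, nulDim]
  congr 2
  all_goals
  ext v
  simp only [LinearMap.mem_ker, mulVecLin_apply, funext_iff, mulVec_diagonal, Pi.zero_apply,
    mul_eq_zero]
  exact forall_congr' fun i => or_iff_not_imp_left

theorem posDim_le_of_injective {M : Matrix ι ι ℂ} {N : Matrix κ κ ℂ}
    (f : (ι → ℂ) →ₗ[ℂ] (κ → ℂ)) (hf : Function.Injective f) (h : ∀ v, qf N (f v) = qf M v) :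
    posDim M ≤ posDim N := by
  obtain ⟨P, hP, hpos⟩ := exists_posOn M
  rw [← hP, (Submodule.equivMapOfInjective f hf P).finrank_eq]
  refine PosOn.finrank_le ?_
  rintro _ ⟨v, hv, rfl⟩ h0
  rw [h]
  exact hpos v hv fun hv0 => h0 (by rw [hv0, map_zero])

/-- Sylvester's law of inertia. -/
theorem posDim_add_posDim_neg_add_nulDim {M : Matrix ι ι ℂ} (hM : M.IsHermitian) :
    posDim M + posDim (-M) + nulDim M = Fintype.card ι := by
  classical
  -- After unitary diagonalization the three numbers count the positive, negative and zero
  -- eigenvalues.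
  let U : Matrix ι ι ℂ := hM.eigenvectorUnitary
  have hU : star U * U = 1 := Unitary.coe_star_mul_self hM.eigenvectorUnitary
  have hU' : U * star U = 1 := Unitary.coe_mul_star_self hM.eigenvectorUnitary
  have hs : M = U * diagonal (fun i => (hM.eigenvalues i : ℂ)) * star U := by
    have := hM.spectral_theorem
    rwa [Unitary.conjStarAlgAut_apply] at this
  set D : Matrix ι ι ℂ := diagonal fun i => (hM.eigenvalues i : ℂ) with hD
  have hq : ∀ v, qf M (U *ᵥ v) = qf D v := by
    intro v
    have h1 : M *ᵥ (U *ᵥ v) = U *ᵥ (D *ᵥ v) := by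
      rw [hs, mulVec_mulVec, mulVec_mulVec, mul_assoc, mul_assoc, hU, mul_one]
    rw [qf, h1, star_mulVec, dotProduct_mulVec, vecMul_vecMul, ← star_eq_conjTranspose, hU,
      vecMul_one, qf]
  have hq' : ∀ v, qf D (star U *ᵥ v) = qf M v := by
    intro v
    rw [← hq, mulVec_mulVec, hU', one_mulVec]
  have inj : Function.Injective U.mulVecLin := fun v w h => by
    have := congrArg (fun x => star U *ᵥ x) h
    simpa [mulVec_mulVec, hU] using this
  have inj' : Function.Injective (star U).mulVecLin := fun v w h => by
    have := congrArg (fun x => U *ᵥ x) h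
    simpa [mulVec_mulVec, hU'] using this
  have hpos : posDim M = posDim D :=
    le_antisymm (posDim_le_of_injective _ inj' hq') (posDim_le_of_injective _ inj hq)
  have hneg : posDim (-M) = posDim (-D) :=
    le_antisymm (posDim_le_of_injective _ inj' fun v => by rw [qf_neg, qf_neg]; simp [hq'])
      (posDim_le_of_injective _ inj fun v => by rw [qf_neg, qf_neg]; simp [hq])
  have hnul : nulDim M = nulDim D := by
    have hle : ∀ (X Y V V' : Matrix ι ι ℂ), Function.Injective V.mulVecLin → Y * V = V' * X →
        nulDim X ≤ nulDim Y := by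
      intro X Y V V' hV h
      rw [nulDim, (Submodule.equivMapOfInjective V.mulVecLin hV (LinearMap.ker _)).finrank_eq]
      refine Submodule.finrank_mono ?_
      rintro _ ⟨v, hv, rfl⟩
      simp only [SetLike.mem_coe, LinearMap.mem_ker, mulVecLin_apply] at hv ⊢
      rw [mulVec_mulVec, h, ← mulVec_mulVec, hv, mulVec_zero]
    refine le_antisymm (hle _ _ (star U) (star U) inj' ?_) (hle _ _ U U inj ?_)
    · rw [hs, ← mul_assoc, ← mul_assoc, hU, one_mul]
    · rw [hs, mul_assoc, hU, mul_one]
  rw [hpos, hneg, hnul, hD, posDim_diagonal, posDim_neg_diagonal, nulDim_diagonal]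
  simp only [Complex.ofReal_eq_zero, Set.coe_ofPred, Nat.card_eq_fintype_card,
    Fintype.card_subtype]
  rw [← Finset.card_univ, ← Finset.card_union_of_disjoint, ← Finset.card_union_of_disjoint]
  · congr 1
    ext i
    simp only [Finset.mem_union, Finset.mem_filter, Finset.mem_univ, true_and, iff_true]
    rcases lt_trichotomy (hM.eigenvalues i) 0 with h | h | h <;> simp [h]
  · rw [Finset.disjoint_left]
    intro i
    simp only [Finset.mem_union, Finset.mem_filter, Finset.mem_univ, true_and]
    rintro (h | h) <;> intro h' <;> linarith
  · rw [Finset.disjoint_left]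
    intro i
    simp only [Finset.mem_filter, Finset.mem_univ, true_and]
    intro h h'
    linarith

/-- The signature of a matrix with arbitrary finite index type. -/
def sgnt (M : Matrix ι ι ℂ) : ℤ := (posDim M : ℤ) - (posDim (-M) : ℤ)

theorem sign_eq_sgnt {n : ℕ} (M : Matrix (Fin n) (Fin n) ℂ) : sign M = sgnt M := rfl

/-! ### Signatures of complementary blocks -/

section Complementary

variable [DecidableEq ι]
  {A Q : Matrix ι ι ℂ} {B : Matrix κ κ ℂ} {F G : Matrix κ ι ℂ}

/-- When the block matrix is invertible, this says that -A and G form the first block column of its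
inverse. -/
theorem fromBlocks_mulVec_complementary (hQ : Fᴴ * G = 1 + Q * A) (hF : F * A = B * G)
    (c : ι → ℂ) :
    fromBlocks Q Fᴴ F B *ᵥ Sum.elim (-(A *ᵥ c)) (G *ᵥ c) = Sum.elim c 0 := by
  rw [fromBlocks_mulVec]
  congr 1
  · simp only [Sum.elim_comp_inl, Sum.elim_comp_inr, mulVec_neg, mulVec_mulVec, hQ, add_mulVec,
      one_mulVec]
    abel
  · simp only [Sum.elim_comp_inl, Sum.elim_comp_inr, mulVec_neg, mulVec_mulVec, hF]
    abel

/-- Let W be the block matrix. The vectors (0, b) and (-Ac, Gc) are W-orthogonal, since W sends the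
latter to (c, 0); their values are those of B at b and of -A at c. Taking b in a maximal positive
subspace plus the kernel of B, and c in a maximal positive subspace of -A, gives a subspace on which
W is nonnegative. As W is non-singular, its dimension is at most `posDim W`. -/
theorem posDim_complementary_le (hA : A.IsHermitian) (hB : B.IsHermitian) (hQh : Q.IsHermitian)
    (hQ : Fᴴ * G = 1 + Q * A) (hF : F * A = B * G)
    (hW : nulDim (fromBlocks Q Fᴴ F B) = 0) :
    posDim B + nulDim B + posDim (-A) ≤ posDim (fromBlocks Q Fᴴ F B) := by
  set W := fromBlocks Q Fᴴ F B with hWdef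
  have hWh : W.IsHermitian := IsHermitian.fromBlocks hQh (by simp) hB
  obtain ⟨P, hP, hPpos⟩ := exists_posOn B
  obtain ⟨P', hP', hPpos'⟩ := exists_posOn (-A)
  have hqB : ∀ v, v ∈ P ⊔ LinearMap.ker B.mulVecLin → 0 ≤ qf B v := by
    intro v hv
    obtain ⟨p, hp, k, hk, rfl⟩ := Submodule.mem_sup.1 hv
    have hk' : B *ᵥ k = 0 := hk
    rw [qf_add_of_orthogonal hB (by rw [hk', dotProduct_zero])]
    have : qf B k = 0 := by simp [qf, hk']
    rw [this, add_zero]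
    by_cases h0 : p = 0
    · rw [h0, qf_zero]
    · exact (hPpos p hp h0).le
  have hdim : Module.finrank ℂ (P ⊔ LinearMap.ker B.mulVecLin : Submodule ℂ (κ → ℂ)) =
      posDim B + nulDim B := by
    have h1 := Submodule.finrank_sup_add_finrank_inf_eq P (LinearMap.ker B.mulVecLin)
    have h2 : P ⊓ LinearMap.ker B.mulVecLin = ⊥ := by
      rw [Submodule.eq_bot_iff]
      rintro v ⟨hv, hv'⟩
      by_contra h0
      have h3 := hPpos v hv h0
      have hv' : B *ᵥ v = 0 := hv'
      simp [qf, hv'] at h3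
    rw [h2, finrank_bot, add_zero, hP] at h1
    exact h1
  let φ : (κ → ℂ) × (ι → ℂ) →ₗ[ℂ] (ι ⊕ κ → ℂ) :=
    { toFun := fun x => Sum.elim (0 : ι → ℂ) x.1 + Sum.elim (-(A *ᵥ x.2)) (G *ᵥ x.2)
      map_add' := fun x y => by
        ext i; cases i <;> simp [mulVec_add] <;> ring
      map_smul' := fun c x => by
        ext i; cases i <;> simp [mulVec_smul]; ring }
  let ψ := φ ∘ₗ LinearMap.prodMap (P ⊔ LinearMap.ker B.mulVecLin).subtype P'.subtype
  have hq : ∀ x, qf W (φ x) = qf B x.1 + qf (-A) x.2 := by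
    intro x
    have hw := fromBlocks_mulVec_complementary hQ hF x.2
    rw [← hWdef] at hw
    change qf W (Sum.elim (0 : ι → ℂ) x.1 + Sum.elim (-(A *ᵥ x.2)) (G *ᵥ x.2)) = _
    rw [qf_add_of_orthogonal hWh]
    · congr 1
      · simp [qf, hWdef, fromBlocks_mulVec, star_sumElim, sumElim_dotProduct_sumElim]
      · rw [qf, hw, star_sumElim, sumElim_dotProduct_sumElim, dotProduct_zero, add_zero, star_neg,
          star_mulVec, hA.eq, qf, neg_dotProduct, neg_mulVec, dotProduct_neg, dotProduct_mulVec]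
    · rw [hw, star_sumElim, sumElim_dotProduct_sumElim]
      simp
  have hinj : Function.Injective ψ := by
    rw [← LinearMap.ker_eq_bot, Submodule.eq_bot_iff]
    rintro ⟨⟨b, hb⟩, ⟨c, hc⟩⟩ hx
    have hx : Sum.elim (0 : ι → ℂ) b + Sum.elim (-(A *ᵥ c)) (G *ᵥ c) = 0 := hx
    have h1 : A *ᵥ c = 0 := by
      ext i
      have := congrFun hx (Sum.inl i)
      simpa using this
    have h2 : c = 0 := by
      by_contra h0
      have := hPpos' c hc h0
      simp [qf, neg_mulVec, h1] at this
    have h3 : b = 0 := by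
      ext i
      have := congrFun hx (Sum.inr i)
      simpa [h2] using this
    subst h2 h3
    rfl
  have hfin : Module.finrank ℂ (LinearMap.range ψ) = posDim B + nulDim B + posDim (-A) := by
    rw [LinearMap.finrank_range_of_inj hinj, Module.finrank_prod, hdim, hP']
  rw [← hfin]
  have h1 := finrank_add_posDim_le (M := -W) (V := LinearMap.range ψ) (by
    rintro _ ⟨⟨⟨b, hb⟩, ⟨c, hc⟩⟩, rfl⟩
    change qf (-W) (φ (b, c)) ≤ 0
    rw [qf_neg, hq, neg_nonpos]
    refine add_nonneg (hqB _ hb) ?_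
    by_cases h0 : c = 0
    · rw [h0, qf_zero]
    · exact (hPpos' _ hc h0).le)
  have h2 := posDim_add_posDim_neg_add_nulDim hWh
  omega

/-- Apply the inequality above to (A, B) and to (-A, -B). With equal nullities the two left sides
add up to the full size of the block matrix, so both are equalities. -/
theorem sgnt_complementary (hA : A.IsHermitian) (hB : B.IsHermitian) (hQh : Q.IsHermitian)
    (hQ : Fᴴ * G = 1 + Q * A) (hF : F * A = B * G)
    (hW : nulDim (fromBlocks Q Fᴴ F B) = 0) (hAB : nulDim A = nulDim B) :
    sgnt (fromBlocks Q Fᴴ F B) = sgnt B - sgnt A := by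
  have h1 := posDim_complementary_le hA hB hQh hQ hF hW
  have hneg : -fromBlocks Q Fᴴ F B = fromBlocks (-Q) (-F)ᴴ (-F) (-B) := by
    rw [fromBlocks_neg, conjTranspose_neg]
  have h2 := posDim_complementary_le (A := -A) (B := -B) (Q := -Q) (F := -F) (G := -G)
    hA.neg hB.neg hQh.neg (by simpa using hQ) (by simpa using hF) (by rw [← hneg, nulDim_neg, hW])
  rw [← hneg, nulDim_neg, neg_neg] at h2
  have h3 := posDim_add_posDim_neg_add_nulDim (IsHermitian.fromBlocks hQh (by simp) hB :
    (fromBlocks Q Fᴴ F B).IsHermitian)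
  have h4 := posDim_add_posDim_neg_add_nulDim hA
  have h5 := posDim_add_posDim_neg_add_nulDim hB
  rw [Fintype.card_sum] at h3
  unfold sgnt
  omega

end Complementary

/-- Positivity on the compact unit sphere of a maximal positive subspace survives a small change of
the matrix. -/
theorem eventually_posDim_le {X : Type*} [TopologicalSpace X] {W : X → Matrix ι ι ℂ}
    (hW : Continuous W) (x : X) : ∀ᶠ y in nhds x, posDim (W x) ≤ posDim (W y) := by
  obtain ⟨P, hP, hpos⟩ := exists_posOn (W x)
  have hc : Continuous fun p : X × (ι → ℂ) => qf (W p.1) p.2 :=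
    Complex.continuous_re.comp (Continuous.dotProduct (continuous_star.comp continuous_snd)
      (Continuous.matrix_mulVec (hW.comp continuous_fst) continuous_snd))
  have hK : IsCompact ((P : Set (ι → ℂ)) ∩ Metric.sphere 0 1) :=
    (isCompact_sphere 0 1).inter_left P.closed_of_finiteDimensional
  have h := hK.eventually_forall_of_forall_eventually (x₀ := x)
    (P := fun y v => 0 < qf (W y) v) (fun v hv =>
      (hc.tendsto (x, v)).eventually (lt_mem_nhds (hpos v hv.1 fun h0 => by
        have := hv.2
        rw [h0] at this
        simp at this)))
  filter_upwards [h] with y hy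
  rw [← hP]
  refine PosOn.finrank_le fun v hv h0 => ?_
  have hn : ‖v‖ ≠ 0 := norm_ne_zero_iff.2 h0
  have h1 := hy ((‖v‖⁻¹ : ℂ) • v) ⟨P.smul_mem _ hv, by simp [norm_smul, hn]⟩
  have h2 : qf (W y) ((‖v‖⁻¹ : ℂ) • v) = ‖v‖⁻¹ ^ 2 * qf (W y) v := by
    simp only [qf, mulVec_smul, star_smul, dotProduct_smul, smul_dotProduct, smul_eq_mul]
    rw [← mul_assoc, ← Complex.ofReal_inv, RCLike.star_def, Complex.conj_ofReal,
      ← Complex.ofReal_mul, Complex.re_ofReal_mul, sq]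
  rw [h2] at h1
  exact (pos_iff_pos_of_mul_pos h1).1 (by positivity)

/-- The signature of a continuous family of non-singular hermitian matrices is constant. -/
theorem sgnt_eq_of_preconnected {X : Type*} [TopologicalSpace X] [PreconnectedSpace X]
    {W : X → Matrix ι ι ℂ} (hW : Continuous W) (hh : ∀ x, (W x).IsHermitian)
    (h0 : ∀ x, nulDim (W x) = 0) (x y : X) : sgnt (W x) = sgnt (W y) := by
  refine IsLocallyConstant.apply_eq_of_preconnectedSpace (f := fun x => sgnt (W x))
    ((IsLocallyConstant.iff_eventually_eq _).2 fun x => ?_) x y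
  -- Both indices of inertia can only increase near x, while their sum is the fixed size; so neither
  -- changes.
  filter_upwards [eventually_posDim_le hW x, eventually_posDim_le hW.neg x] with y h1 h2
  have h3 := posDim_add_posDim_neg_add_nulDim (hh x)
  have h4 := posDim_add_posDim_neg_add_nulDim (hh y)
  rw [h0] at h3 h4
  simp only [sgnt]
  simp only [Pi.neg_apply] at h2
  omega

end Inertia

/-! ### Symmetric Laurent polynomials -/

section Symmetric

open Polynomial

/-- The embedding `ℝ[X] → ℝ[t, t⁻¹]` with `X ↦ t + t⁻¹`. -/
def ofPoly : ℝ[X] →ₐ[ℝ] Lam := aeval (LaurentPolynomial.T 1 + LaurentPolynomial.T (-1))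

theorem ofPoly_X : ofPoly X = LaurentPolynomial.T 1 + LaurentPolynomial.T (-1) := aeval_X _

theorem ofPoly_C (c : ℝ) : ofPoly (C c) = LaurentPolynomial.C c := aeval_C _ _

theorem conj_T (n : ℤ) : conj (LaurentPolynomial.T n) = LaurentPolynomial.T (-n) :=
  LaurentPolynomial.invert_T n

theorem conj_C (c : ℝ) : conj (LaurentPolynomial.C c) = LaurentPolynomial.C c :=
  LaurentPolynomial.invert_C c

theorem conj_ofPoly (P : ℝ[X]) : conj (ofPoly P) = ofPoly P := by
  induction P using Polynomial.induction_on' with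
  | add p q hp hq => rw [map_add, map_add, hp, hq]
  | monomial n a =>
    rw [← C_mul_X_pow_eq_monomial, map_mul, map_pow, map_mul, map_pow, ofPoly_X, ofPoly_C, conj_C,
      map_add, conj_T, conj_T, neg_neg, add_comm]

/-- Evaluation of a real Laurent polynomial at a non-zero complex number. -/
abbrev ev (z : ℂˣ) : Lam →+* ℂ := LaurentPolynomial.eval₂ (algebraMap ℝ ℂ) z

theorem ev_T (z : ℂˣ) (n : ℤ) : ev z (LaurentPolynomial.T n) = (z ^ n : ℂˣ) :=
  LaurentPolynomial.eval₂_T _ _ _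

theorem ev_C (z : ℂˣ) (c : ℝ) : ev z (LaurentPolynomial.C c) = c :=
  LaurentPolynomial.eval₂_C _ _ _

theorem ev_ofPoly (z : ℂˣ) (P : ℝ[X]) : ev z (ofPoly P) = aeval ((z : ℂ) + (z : ℂ)⁻¹) P := by
  induction P using Polynomial.induction_on' with
  | add p q hp hq => rw [map_add, map_add, map_add, hp, hq]
  | monomial n a =>
    rw [← C_mul_X_pow_eq_monomial, map_mul, map_pow, map_mul, map_pow, ofPoly_X, ofPoly_C, ev_C,
      map_add, ev_T, ev_T, map_mul, map_pow, aeval_C, aeval_X]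
    simp

/-- The roots of Z² - wZ + 1 have product 1. Thus t + t⁻¹ takes every complex value, and zeros of
polynomials in X lift to points of ℂ ∖ {0}. -/
theorem exists_add_inv_eq (w : ℂ) : ∃ z : ℂˣ, (z : ℂ) + (z : ℂ)⁻¹ = w := by
  obtain ⟨s, hs⟩ := IsAlgClosed.exists_eq_mul_self (w ^ 2 - 4)
  have h : (w + s) / 2 * ((w - s) / 2) = 1 := by linear_combination hs / 4
  refine ⟨⟨(w + s) / 2, (w - s) / 2, h, by rw [mul_comm, h]⟩, ?_⟩
  rw [Units.val_mk, inv_eq_of_mul_eq_one_right h]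
  ring

theorem ofPoly_injective : Function.Injective ofPoly := by
  rw [injective_iff_map_eq_zero]
  intro P hP
  have h : P.map (algebraMap ℝ ℂ) = 0 := by
    refine Polynomial.funext fun w => ?_
    obtain ⟨z, rfl⟩ := exists_add_inv_eq w
    rw [eval_zero, eval_map_algebraMap, ← ev_ofPoly, hP, map_zero]
  exact (Polynomial.map_eq_zero _).1 h

theorem ofPoly_ne_zero {P : ℝ[X]} (h : P ≠ 0) : ofPoly P ≠ 0 :=
  (map_ne_zero_iff _ ofPoly_injective).2 h

/-- This is why the interval [-2, 2] stands for the unit circle from here on. -/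
theorem circle_add_inv (z : Circle) :
    ((Circle.toUnits z : ℂˣ) : ℂ) + ((Circle.toUnits z : ℂˣ) : ℂ)⁻¹ =
      ((2 * (z : ℂ).re : ℝ) : ℂ) := by
  rw [Circle.toUnits_apply, Units.val_mk0, ← Circle.coe_inv, Circle.coe_inv_eq_conj,
    Complex.add_conj]

theorem exists_circle_re {c : ℝ} (hc : c ∈ Set.Icc (-2 : ℝ) 2) :
    ∃ z : Circle, 2 * (z : ℂ).re = c := by
  refine ⟨Circle.exp (Real.arccos (c / 2)), ?_⟩
  rw [Circle.coe_exp, Complex.exp_ofReal_mul_I_re, Real.cos_arccos] <;> linarith [hc.1, hc.2]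

theorem ev_circle_ofPoly (z : Circle) (P : ℝ[X]) :
    ev (Circle.toUnits z) (ofPoly P) = (P.eval (2 * (z : ℂ).re) : ℝ) := by
  rw [ev_ofPoly, circle_add_inv]
  exact aeval_algebraMap_apply_eq_algebraMap_eval _ _

theorem ev_conj (z : Circle) (p : Lam) :
    ev (Circle.toUnits z) (conj p) = star (ev (Circle.toUnits z) p) := by
  induction p using LaurentPolynomial.induction_on' with
  | add p q hp hq => rw [map_add, map_add, map_add, star_add, hp, hq]
  | C_mul_T n a =>
    rw [map_mul, map_mul, map_mul, conj_C, conj_T, ev_C, ev_T, ev_T, star_mul', ← map_zpow,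
      ← map_zpow, Circle.toUnits_apply, Circle.toUnits_apply, Units.val_mk0, Units.val_mk0,
      _root_.zpow_neg, Circle.coe_inv_eq_conj]
    simp

/-- The elements 1 and t generate Λ over ℝ[X], because t² = Xt - 1 and t⁻¹ = X - t. -/
theorem exists_ofPoly_add_T_mul (p : Lam) :
    ∃ P Q : ℝ[X], p = ofPoly P + LaurentPolynomial.T 1 * ofPoly Q := by
  have h11 : (LaurentPolynomial.T 1 * LaurentPolynomial.T (-1) : Lam) = 1 := by
    rw [← LaurentPolynomial.T_add]; simp
  induction p using LaurentPolynomial.induction_on with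
  | h_C a => exact ⟨C a, 0, by rw [ofPoly_C]; simp⟩
  | h_add hp hq =>
    obtain ⟨P, Q, rfl⟩ := hp
    obtain ⟨P', Q', rfl⟩ := hq
    exact ⟨P + P', Q + Q', by rw [map_add, map_add]; ring⟩
  | h_C_mul_T n a h =>
    obtain ⟨P, Q, h⟩ := h
    refine ⟨-Q, P + X * Q, ?_⟩
    rw [LaurentPolynomial.T_add, ← mul_assoc, h, map_add, map_neg, map_mul, ofPoly_X]
    linear_combination - ofPoly Q * h11
  | h_C_mul_T_Z n a h =>
    obtain ⟨P, Q, h⟩ := h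
    refine ⟨X * P + Q, -P, ?_⟩
    rw [LaurentPolynomial.T_sub, ← mul_assoc, h, map_add, map_neg, map_mul, ofPoly_X]
    linear_combination ofPoly Q * h11

theorem T_sub_T_ne_zero : (LaurentPolynomial.T 1 - LaurentPolynomial.T (-1) : Lam) ≠ 0 := by
  intro h
  have h2 := congrArg (ev (Units.mk0 2 two_ne_zero)) h
  rw [map_sub, ev_T, ev_T] at h2
  norm_num at h2

/-- The Laurent polynomials which are invariant under the involution are polynomials in
`t + t⁻¹`. -/
theorem exists_ofPoly_eq {p : Lam} (hp : conj p = p) : ∃ P : ℝ[X], ofPoly P = p := by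
  obtain ⟨P, Q, rfl⟩ := exists_ofPoly_add_T_mul p
  rw [map_add, map_mul, conj_T, conj_ofPoly, conj_ofPoly] at hp
  -- Compare P + tQ with its conjugate P + t⁻¹Q.
  have h : (LaurentPolynomial.T 1 - LaurentPolynomial.T (-1) : Lam) * ofPoly Q = 0 := by
    linear_combination - hp
  rcases mul_eq_zero.1 h with h | h
  · exact absurd h T_sub_T_ne_zero
  · exact ⟨P, by rw [h]; simp⟩

/-- The real Fejér-Riesz theorem. -/
theorem exists_mul_conj_eq_ofPoly (P : ℝ[X]) (hP : ∀ x ∈ Set.Icc (-2 : ℝ) 2, 0 < P.eval x) :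
    ∃ w : Lam, w * conj w = ofPoly P := by
  induction hn : P.natDegree using Nat.strong_induction_on generalizing P with
  | _ n ih =>
  subst hn
  have h11 : (LaurentPolynomial.T 1 * LaurentPolynomial.T (-1) : Lam) = 1 := by
    rw [← LaurentPolynomial.T_add]; simp
  have hP0 : P ≠ 0 := by
    rintro rfl
    simpa using hP 0 (by norm_num)
  -- it suffices to split off a factor which is itself of the required form
  have key : ∀ A B : ℝ[X], P = A * B → 0 < A.natDegree →
      (∀ x ∈ Set.Icc (-2 : ℝ) 2, 0 < A.eval x) → (∃ w : Lam, w * conj w = ofPoly A) →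
      ∃ w : Lam, w * conj w = ofPoly P := by
    rintro A B rfl hA hApos ⟨w, hw⟩
    have hB : ∀ x ∈ Set.Icc (-2 : ℝ) 2, 0 < B.eval x := fun x hx => by
      have := hP x hx
      rw [eval_mul] at this
      exact (pos_iff_pos_of_mul_pos this).1 (hApos x hx)
    obtain ⟨v, hv⟩ := ih B.natDegree (by
      rw [natDegree_mul (left_ne_zero_of_mul hP0) (right_ne_zero_of_mul hP0)]; omega) B hB rfl
    exact ⟨w * v, by rw [map_mul, map_mul, ← hw, ← hv]; ring⟩
  by_cases hdeg : P.natDegree = 0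
  · obtain ⟨c, rfl⟩ := natDegree_eq_zero.1 hdeg
    have hc : 0 < c := by simpa using hP 0 (by norm_num)
    refine ⟨LaurentPolynomial.C (Real.sqrt c), ?_⟩
    rw [conj_C, ofPoly_C, ← map_mul, Real.mul_self_sqrt hc.le]
  by_cases hroot : ∃ r : ℝ, P.IsRoot r
  · obtain ⟨r, hr⟩ := hroot
    have hr2 : ¬ r ∈ Set.Icc (-2 : ℝ) 2 := fun h => by
      have := hP r h
      rw [hr.eq_zero] at this
      exact lt_irrefl _ this
    obtain ⟨B, hB⟩ := dvd_iff_isRoot.2 hr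
    -- A real root r of P lies outside [-2, 2], so a + a⁻¹ = r has a real solution. Then (1 - at)(1
    -- - at⁻¹) = a(r - X) is the norm to split off.
    obtain ⟨a, ha0, ha⟩ : ∃ a : ℝ, a ≠ 0 ∧ a ^ 2 + 1 = a * r := by
      have h4 : 0 ≤ r ^ 2 - 4 := by
        by_contra h
        exact hr2 ⟨by nlinarith, by nlinarith⟩
      refine ⟨(r + Real.sqrt (r ^ 2 - 4)) / 2, fun h => ?_, ?_⟩
      · have h5 := Real.sq_sqrt h4
        have h6 : Real.sqrt (r ^ 2 - 4) = -r := by linarith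
        rw [h6] at h5
        linarith
      · linear_combination Real.sq_sqrt h4 / 4
    have ha' : ∀ x ∈ Set.Icc (-2 : ℝ) 2, 0 < a * (r - x) := by
      intro x hx
      have h1 : a * (r - x) = a ^ 2 + 1 - a * x := by rw [mul_sub, ha]
      have h2 : 0 ≤ a * (r - x) := by
        rw [h1]
        nlinarith [hx.1, hx.2, sq_nonneg (a - 1), sq_nonneg (a + 1), sq_nonneg (a - x / 2)]
      refine lt_of_le_of_ne h2 (Ne.symm (mul_ne_zero ha0 (sub_ne_zero.2 ?_)))
      rintro rfl
      exact hr2 hx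
    have hA : (C (a ^ 2 + 1) - C a * X : ℝ[X]) = -(C a * (X - C r)) := by
      rw [ha, map_mul]; ring
    refine key (C (a ^ 2 + 1) - C a * X) (-C a⁻¹ * B) ?_ ?_ (fun x hx => ?_)
      ⟨1 - LaurentPolynomial.C a * LaurentPolynomial.T 1, ?_⟩
    · rw [hA, hB]
      have : (C a * C a⁻¹ : ℝ[X]) = 1 := by rw [← C_mul, mul_inv_cancel₀ ha0, C_1]
      linear_combination - (X - C r) * B * this
    · rw [hA, natDegree_neg, natDegree_C_mul ha0, natDegree_X_sub_C]; exact one_pos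
    · have := ha' x hx
      rw [mul_sub, ← ha] at this
      simpa using this
    · rw [map_sub, map_mul, conj_C, conj_T, map_sub, map_mul, ofPoly_X, ofPoly_C, ofPoly_C,
        map_one, map_add, map_pow, map_one]
      linear_combination LaurentPolynomial.C a ^ 2 * h11
  · obtain ⟨γ, hγ⟩ := IsAlgClosed.exists_aeval_eq_zero ℂ P
      (natDegree_pos_iff_degree_pos.1 (Nat.pos_of_ne_zero hdeg)).ne'
    have him : γ.im ≠ 0 := fun him => by
      refine hroot ⟨γ.re, ?_⟩
      have h1 : γ = algebraMap ℝ ℂ γ.re := by apply Complex.ext <;> simp [him]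
      rw [h1, aeval_algebraMap_apply_eq_algebraMap_eval] at hγ
      exact (map_eq_zero _).1 hγ
    obtain ⟨B, hB⟩ := P.quadratic_dvd_of_aeval_eq_zero_im_ne_zero hγ him
    -- For a non-real root γ = α + α⁻¹, the real polynomial (1 - αt)(1 - α̅t) = 1 - st + mt² has s =
    -- 2 Re α and m = |α|². Its norm is m(X - γ)(X - γ̅).
    obtain ⟨α, hα⟩ := exists_add_inv_eq γ
    obtain ⟨s, hs⟩ : ∃ s : ℝ, s = 2 * (α : ℂ).re := ⟨_, rfl⟩
    obtain ⟨m, hm⟩ : ∃ m : ℝ, m = Complex.normSq α := ⟨_, rfl⟩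
    have hm0 : 0 < m := by rw [hm]; exact Complex.normSq_pos.2 α.ne_zero
    have e1 : m * (2 * γ.re) = s * (1 + m) := by
      rw [← hα, Complex.add_re, Complex.inv_re, ← hm, hs]
      field_simp
      ring
    have e2 : m * ‖γ‖ ^ 2 = 1 + s ^ 2 + m ^ 2 - (m + m) := by
      have h1 : m * Complex.normSq γ = Complex.normSq ((α : ℂ) * (α : ℂ) + 1) := by
        rw [hm, ← Complex.normSq_mul, ← hα, mul_add, mul_inv_cancel₀ α.ne_zero]
      rw [← Complex.normSq_eq_norm_sq, h1, hs, hm, Complex.normSq_apply, Complex.normSq_apply]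
      simp only [Complex.add_re, Complex.mul_re, Complex.one_re, Complex.add_im, Complex.mul_im,
        Complex.one_im]
      ring
    have hmC : (C m * C m⁻¹ : ℝ[X]) = 1 := by rw [← C_mul, mul_inv_cancel₀ hm0.ne', C_1]
    refine key (C m * (X ^ 2 - C (2 * γ.re) * X + C (‖γ‖ ^ 2))) (C m⁻¹ * B) ?_ ?_ (fun x _ => ?_)
      ⟨1 - LaurentPolynomial.C s * LaurentPolynomial.T 1 +
        LaurentPolynomial.C m * LaurentPolynomial.T 1 ^ 2, ?_⟩
    · rw [hB]
      linear_combination - (X ^ 2 - C (2 * γ.re) * X + C (‖γ‖ ^ 2)) * B * hmC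
    · rw [natDegree_C_mul hm0.ne']
      have : (X ^ 2 - C (2 * γ.re) * X + C (‖γ‖ ^ 2) : ℝ[X]).natDegree = 2 := by compute_degree!
      omega
    · have h1 : 0 < γ.im ^ 2 := by positivity
      have h2 : ‖γ‖ ^ 2 = γ.re ^ 2 + γ.im ^ 2 := by
        rw [← Complex.normSq_eq_norm_sq, Complex.normSq_apply]; ring
      simp only [eval_mul, eval_add, eval_sub, eval_pow, eval_X, eval_C, h2]
      refine mul_pos hm0 ?_
      nlinarith [sq_nonneg (x - γ.re)]
    · have e1' : ofPoly (C m) * ofPoly (C (2 * γ.re)) =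
          LaurentPolynomial.C s * (1 + LaurentPolynomial.C m) := by
        rw [← map_mul, ← C_mul, e1, ofPoly_C, map_mul, map_add, map_one]
      have e2' : ofPoly (C m) * ofPoly (C (‖γ‖ ^ 2)) =
          1 + LaurentPolynomial.C s ^ 2 + LaurentPolynomial.C m ^ 2 -
            (LaurentPolynomial.C m + LaurentPolynomial.C m) := by
        rw [← map_mul, ← C_mul, e2, ofPoly_C]
        simp only [map_sub, map_add, map_pow, map_one]
      have e3 : ofPoly (C m * (X ^ 2 - C (2 * γ.re) * X + C (‖γ‖ ^ 2))) =
          LaurentPolynomial.C m * (LaurentPolynomial.T 1 + LaurentPolynomial.T (-1)) ^ 2 -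
          LaurentPolynomial.C s * (1 + LaurentPolynomial.C m) *
            (LaurentPolynomial.T 1 + LaurentPolynomial.T (-1)) +
          (1 + LaurentPolynomial.C s ^ 2 + LaurentPolynomial.C m ^ 2 -
            (LaurentPolynomial.C m + LaurentPolynomial.C m)) := by
        rw [← e1', ← e2', map_mul, map_add, map_sub, map_mul, map_pow, ofPoly_X, ofPoly_C m]
        ring
      rw [e3]
      simp only [map_add, map_sub, map_mul, map_pow, map_one, conj_C, conj_T]
      generalize (LaurentPolynomial.T 1 : Lam) = t at *
      generalize (LaurentPolynomial.T (-1) : Lam) = t' at *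
      generalize (LaurentPolynomial.C s : Lam) = s' at *
      generalize (LaurentPolynomial.C m : Lam) = m' at *
      linear_combination (s' ^ 2 - s' * m' * (t + t') + m' ^ 2 * (1 + t * t') - 2 * m') * h11

/-- A symmetric element which is positive at the zeros of `f` in `[-2, 2]` is a norm
modulo `f`. -/
theorem exists_dvd_mul_conj_sub {f u : ℝ[X]}
    (hu : ∀ x ∈ Set.Icc (-2 : ℝ) 2, f.IsRoot x → 0 < u.eval x) :
    ∃ w : Lam, ofPoly f ∣ w * conj w - ofPoly u := by
  -- Adding a multiple of f² does not change u modulo f. On the compact part of [-2, 2] where u ≤ 0,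
  -- f has no zero, so a large multiple makes the sum positive on the whole interval, and
  -- Fejér-Riesz applies.
  obtain ⟨K, hK⟩ : ∃ K : ℝ, ∀ x ∈ Set.Icc (-2 : ℝ) 2, 0 < u.eval x + K * (f.eval x) ^ 2 := by
    have hZ : IsCompact (Set.Icc (-2 : ℝ) 2 ∩ {x | u.eval x ≤ 0}) :=
      isCompact_Icc.inter_right (isClosed_le u.continuous continuous_const)
    have hf : ∀ x ∈ Set.Icc (-2 : ℝ) 2 ∩ {x | u.eval x ≤ 0}, f.eval x ^ 2 ≠ 0 := fun x hx h0 =>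
      absurd (hu x hx.1 (pow_eq_zero_iff two_ne_zero |>.1 h0)) (not_lt.2 hx.2)
    have hc : ContinuousOn (fun x => -u.eval x / f.eval x ^ 2)
        (Set.Icc (-2 : ℝ) 2 ∩ {x | u.eval x ≤ 0}) :=
      u.continuous.neg.continuousOn.div (f.continuous.pow 2).continuousOn hf
    obtain ⟨K, hK⟩ := (hZ.image_of_continuousOn hc).bddAbove
    refine ⟨max K 0 + 1, fun x hx => ?_⟩
    by_cases hux : u.eval x ≤ 0
    · have h1 := hK ⟨x, ⟨hx, hux⟩, rfl⟩
      have h2 : 0 < f.eval x ^ 2 := lt_of_le_of_ne (sq_nonneg _) (hf x ⟨hx, hux⟩).symm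
      simp only at h1
      rw [div_le_iff₀ h2] at h1
      nlinarith [le_max_left K 0]
    · have : 0 ≤ (max K 0 + 1) * f.eval x ^ 2 := by positivity
      linarith
  obtain ⟨w, hw⟩ := exists_mul_conj_eq_ofPoly (u + C K * f ^ 2) (fun x hx => by
    simpa using hK x hx)
  refine ⟨w, ofPoly (C K * f), ?_⟩
  rw [hw, map_add, map_mul, map_mul, map_pow]
  ring

end Symmetric

/-! ### Forms and generators -/

/-- Hermitian forms with trivial radical. -/
structure IsNondeg {H : Type*} [AddCommGroup H] [Module Lam H] (lam : Form H) : Prop where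
  hermitian : ∀ a b : H, lam a b = conjOmLam (lam b a)
  nondeg : ∀ a : H, (∀ b, lam a b = 0) → a = 0

theorem IsBlanchfield.isNondeg {H : Type*} [AddCommGroup H] [Module Lam H] {lam : Form H}
    (h : IsBlanchfield lam) : IsNondeg lam :=
  ⟨h.hermitian, fun a ha => h.nonsingular.1
    ((LinearMap.ext ha : lam a = 0).trans (map_zero lam).symm)⟩

/-- The class of an element of `ℝ(t)` in `ℝ(t) / ℝ[t, t⁻¹]`. -/
def cls : Om →ₗ[Lam] OmLam := Submodule.mkQ _

theorem cls_eq_zero {x : Om} : cls x = 0 ↔ ∃ p : Lam, algebraMap Lam Om p = x :=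
  (Submodule.Quotient.mk_eq_zero _).trans LinearMap.mem_range

theorem cls_algebraMap (p : Lam) : cls (algebraMap Lam Om p) = 0 := cls_eq_zero.2 ⟨p, rfl⟩

theorem cls_surjective : Function.Surjective cls := Submodule.mkQ_surjective _

theorem conjOmLam_cls (x : Om) : conjOmLam (cls x) = cls (conjOm x) := rfl

theorem conjOm_mul (x y : Om) : conjOm (x * y) = conjOm x * conjOm y :=
  map_mul (IsFractionRing.ringEquivOfRingEquiv (K := Om) (L := Om)
    (LaurentPolynomial.invert (R := ℝ)).toRingEquiv) x y

theorem conjOm_one : conjOm 1 = 1 :=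
  map_one (IsFractionRing.ringEquivOfRingEquiv (K := Om) (L := Om)
    (LaurentPolynomial.invert (R := ℝ)).toRingEquiv)

theorem formOf_mk' {n : ℕ} (A : Matrix (Fin n) (Fin n) Lam) (hA : IsHerm A) (hd : A.det ≠ 0)
    (a b : Fin n → Lam) :
    formOf A hA hd (Submodule.Quotient.mk a) (Submodule.Quotient.mk b) = cls (pairing A a b) := rfl

/-- The conjugate transpose of a matrix over `ℝ[t, t⁻¹]`. -/
def ct {ι κ : Type*} (M : Matrix ι κ Lam) : Matrix κ ι Lam := (M.map conj)ᵀ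

section ConjTranspose

variable {ι κ τ : Type*}

theorem ct_apply (M : Matrix ι κ Lam) (i : κ) (j : ι) : ct M i j = conj (M j i) := rfl

theorem ct_ct (M : Matrix ι κ Lam) : ct (ct M) = M := by
  ext i j : 1
  exact conj_conj _

theorem ct_mul [Fintype κ] (M : Matrix ι κ Lam) (N : Matrix κ τ Lam) :
    ct (M * N) = ct N * ct M := by
  rw [ct, Matrix.map_mul, transpose_mul, ct, ct]

theorem ct_add (M N : Matrix ι κ Lam) : ct (M + N) = ct M + ct N := by
  rw [ct, Matrix.map_add _ (map_add _), transpose_add, ct, ct]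

theorem ct_one [DecidableEq ι] : ct (1 : Matrix ι ι Lam) = 1 := by
  rw [ct, Matrix.map_one _ (map_zero _) (map_one _), transpose_one]

end ConjTranspose

/-! ### Symmetry and radical of the pairing of a hermitian matrix -/

section Pairing

variable {n : ℕ} {A : Matrix (Fin n) (Fin n) Lam}

theorem pairing_eq_sum (A : Matrix (Fin n) (Fin n) Lam) (a b : Fin n → Lam) :
    pairing A a b = ∑ i, ∑ j, conj (a i) • b j • (A.map (algebraMap Lam Om))⁻¹ i j := by
  simp only [pairing, dotProduct, mulVec, Finset.mul_sum, Algebra.smul_def]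
  exact Finset.sum_congr rfl fun i _ => Finset.sum_congr rfl fun j _ => by ring

theorem pairing_single_right (A : Matrix (Fin n) (Fin n) Lam) (b : Fin n → Lam) (i : Fin n) :
    pairing A (Pi.single i 1) b =
      ((A.map (algebraMap Lam Om))⁻¹ *ᵥ fun j => algebraMap Lam Om (b j)) i := by
  have h : (fun j => algebraMap Lam Om (conj ((Pi.single i 1 : Fin n → Lam) j))) =
      Pi.single i 1 := by
    funext j
    rcases eq_or_ne j i with rfl | h
    · simp
    · simp [h]
  rw [pairing, h, single_one_dotProduct]

theorem conjOm_inv_apply (hA : IsHerm A) (hd : A.det ≠ 0) (i j : Fin n) :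
    conjOm ((A.map (algebraMap Lam Om))⁻¹ i j) = (A.map (algebraMap Lam Om))⁻¹ j i := by
  set M := A.map (algebraMap Lam Om) with hM
  have hMh : (M.map conjOm)ᵀ = M := by
    ext i j : 1
    rw [transpose_apply, map_apply, hM, map_apply, conjOm_algebraMap, map_apply]
    exact congrArg _ (congrFun (congrFun hA i) j)
  have h : (M⁻¹.map conjOm)ᵀ * M = 1 := by
    have : M.map conjOm * M⁻¹.map conjOm = (M * M⁻¹).map conjOm := by
      ext i j : 1
      simp only [mul_apply, map_apply, map_sum, conjOm_mul]
    rw [← hMh, ← transpose_mul, hMh, this, mul_nonsing_inv _ (isUnit_det_map A hd), Matrix.map_one _ (map_zero _) conjOm_one,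
      transpose_one]
  have h2 := inv_eq_left_inv h
  exact (congrFun (congrFun h2 j) i).symm

theorem conjOm_pairing (hA : IsHerm A) (hd : A.det ≠ 0) (a b : Fin n → Lam) :
    conjOm (pairing A a b) = pairing A b a := by
  rw [pairing_eq_sum, pairing_eq_sum, map_sum, Finset.sum_comm]
  simp only [map_sum]
  refine Finset.sum_congr rfl fun i _ => Finset.sum_congr rfl fun j _ => ?_
  rw [map_smulₛₗ, map_smulₛₗ, conj_conj, conjOm_inv_apply hA hd, smul_comm]

/-- Pairing with the standard basis shows that the coordinates of A⁻¹b lie in Λ. -/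
theorem mem_range_of_pairing (hd : A.det ≠ 0) {b : Fin n → Lam}
    (h : ∀ a, cls (pairing A a b) = 0) : b ∈ LinearMap.range A.mulVecLin := by
  have h1 : ∀ i, ∃ p : Lam, algebraMap Lam Om p = pairing A (Pi.single i 1) b := fun i =>
    cls_eq_zero.1 (h _)
  choose c hc using h1
  refine ⟨c, ?_⟩
  funext i
  refine IsFractionRing.injective Lam Om ?_
  have h2 : (fun i => algebraMap Lam Om (c i)) =
      (A.map (algebraMap Lam Om))⁻¹ *ᵥ fun j => algebraMap Lam Om (b j) := by
    funext i
    rw [hc, pairing_single_right]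
  rw [mulVecLin_apply, RingHom.map_mulVec]
  change ((A.map (algebraMap Lam Om)) *ᵥ fun i => algebraMap Lam Om (c i)) i = _
  rw [h2, mulVec_mulVec, mul_nonsing_inv _ (isUnit_det_map A hd), one_mulVec]

theorem isNondeg_formOf (hA : IsHerm A) (hd : A.det ≠ 0) : IsNondeg (formOf A hA hd) := by
  constructor
  · intro a b
    obtain ⟨a, rfl⟩ := Submodule.Quotient.mk_surjective _ a
    obtain ⟨b, rfl⟩ := Submodule.Quotient.mk_surjective _ b
    rw [formOf_mk', formOf_mk', conjOmLam_cls, conjOm_pairing hA hd]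
  · intro a ha
    obtain ⟨a, rfl⟩ := Submodule.Quotient.mk_surjective _ a
    rw [Submodule.Quotient.mk_eq_zero]
    refine mem_range_of_pairing hd fun b => ?_
    have h := congrArg conjOmLam (ha (Submodule.Quotient.mk b))
    rwa [formOf_mk', conjOmLam_cls, conjOm_pairing hA hd, map_zero] at h

end Pairing

/-! ### Presentations of a form by a matrix -/

section Generators

variable {H : Type*} [AddCommGroup H] [Module Lam H] {lam : Form H} {n : ℕ}
  {A : Matrix (Fin n) (Fin n) Lam}

/-- The images of the standard basis under a presentation of `H` by `A` which is compatible with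
the forms. -/
structure Presents (A : Matrix (Fin n) (Fin n) Lam) (lam : Form H)
    (f : (Fin n → Lam) →ₗ[Lam] H) : Prop where
  surjective : Function.Surjective f
  ker : LinearMap.ker f = LinearMap.range A.mulVecLin
  form : ∀ a b, lam (f a) (f b) = cls (pairing A a b)

theorem Represents.exists_presents (h : Represents A lam) :
    ∃ f : (Fin n → Lam) →ₗ[Lam] H, Presents A lam f := by
  obtain ⟨hA, hd, e, he⟩ := h
  refine ⟨e.toLinearMap ∘ₗ Submodule.mkQ _, ?_, ?_, ?_⟩
  · exact e.surjective.comp (Submodule.mkQ_surjective _)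
  · rw [LinearEquiv.ker_comp, Submodule.ker_mkQ]
  · intro a b
    exact he _ _

theorem Presents.represents {f : (Fin n → Lam) →ₗ[Lam] H} (h : Presents A lam f) (hA : IsHerm A)
    (hd : A.det ≠ 0) : Represents A lam := by
  refine ⟨hA, hd, (Submodule.quotEquivOfEq _ _ h.ker.symm).trans
    (f.quotKerEquivOfSurjective h.surjective), ?_⟩
  intro a b
  obtain ⟨a, rfl⟩ := Submodule.Quotient.mk_surjective _ a
  obtain ⟨b, rfl⟩ := Submodule.Quotient.mk_surjective _ b
  exact h.form a b

/-- A form with trivial radical is represented by `A` if the module has generators whose Gram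
matrix is `A⁻¹`. -/
theorem IsNondeg.represents (hl : IsNondeg lam) (hA : IsHerm A) (hd : A.det ≠ 0)
    (z : Fin n → H) (hz : Submodule.span Lam (Set.range z) = ⊤)
    (h : ∀ i j, lam (z i) (z j) = cls ((A.map (algebraMap Lam Om))⁻¹ i j)) :
    Represents A lam := by
  let f : (Fin n → Lam) →ₗ[Lam] H := Fintype.linearCombination Lam z
  have hf : Function.Surjective f := by
    rw [← LinearMap.range_eq_top, Fintype.range_linearCombination, hz]
  have hform : ∀ a b, lam (f a) (f b) = cls (pairing A a b) := by
    intro a b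
    simp only [f, Fintype.linearCombination_apply, map_sum, LinearMap.sum_apply, map_smulₛₗ,
      LinearMap.smul_apply, h, pairing_eq_sum, RingHom.id_apply, Finset.smul_sum]
    rw [Finset.sum_comm]
    exact Finset.sum_congr rfl fun i _ => Finset.sum_congr rfl fun j _ => smul_comm _ _ _
  refine Presents.represents (f := f) ⟨hf, ?_, hform⟩ hA hd
  -- Both sides are the radical of the form pulled back along `f`: the form on `H` has trivial
  -- radical, and that of `pairing A` modulo Λ is the image of A.
  ext b
  constructor
  · intro hb
    refine mem_range_of_pairing hd fun a => ?_
    rw [← hform, LinearMap.mem_ker.1 hb, map_zero]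
  · rintro ⟨c, rfl⟩
    refine hl.nondeg _ fun x => ?_
    obtain ⟨x, rfl⟩ := hf x
    rw [hform, mulVecLin_apply, pairing_mulVec_left A hA hd, cls_algebraMap]

end Generators

/-! ### Independence of the representing matrix -/

section Independence

variable {H : Type*} [AddCommGroup H] [Module Lam H] {lam : Form H} {n m : ℕ}
  {A : Matrix (Fin n) (Fin n) Lam} {B : Matrix (Fin m) (Fin m) Lam}

theorem exists_matrix_lift {n m : ℕ} {f : (Fin n → Lam) →ₗ[Lam] H} (hf : Function.Surjective f)
    (g : (Fin m → Lam) →ₗ[Lam] H) :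
    ∃ F : Matrix (Fin n) (Fin m) Lam, ∀ v, f (F *ᵥ v) = g v := by
  choose s hs using fun j => hf (g (Pi.single j 1))
  refine ⟨Matrix.of fun i j => s j i, ?_⟩
  have h : f ∘ₗ (Matrix.of fun i j => s j i).mulVecLin = g := by
    refine LinearMap.pi_ext' fun j => LinearMap.ext_ring ?_
    simp only [LinearMap.comp_apply, LinearMap.single_apply, mulVecLin_apply, mulVec_single_one]
    exact hs j
  exact fun v => LinearMap.congr_fun h v

theorem Presents.exists_eq_mul {f : (Fin n → Lam) →ₗ[Lam] H} (hf : Presents A lam f) {κ : Type*}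
    [Fintype κ] [DecidableEq κ] {M : Matrix (Fin n) κ Lam} (hM : ∀ v, f (M *ᵥ v) = 0) :
    ∃ Y : Matrix (Fin n) κ Lam, M = A * Y := by
  have h : ∀ j, ∃ c, A *ᵥ c = M.col j := fun j => by
    have h1 : M.col j ∈ LinearMap.ker f := by
      rw [← mulVec_single_one]
      exact hM _
    rw [hf.ker] at h1
    exact h1
  choose c hc using h
  refine ⟨Matrix.of fun i j => c j i, ?_⟩
  ext i j : 1
  exact (congrFun (hc j) i).symm

theorem Presents.apply_mulVec {f : (Fin n → Lam) →ₗ[Lam] H} (hf : Presents A lam f)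
    (v : Fin n → Lam) : f (A *ᵥ v) = 0 := by
  rw [← LinearMap.mem_ker, hf.ker]
  exact ⟨v, rfl⟩

theorem mul_left_cancel_of_det_ne_zero {κ : Type*} (hd : A.det ≠ 0) {X Y : Matrix (Fin n) κ Lam}
    (h : A * X = A * Y) : X = Y := by
  have h1 := congrArg (fun Z => A.adjugate * Z) h
  simp only [← Matrix.mul_assoc, adjugate_mul, smul_mul, Matrix.one_mul] at h1
  ext i j : 1
  have h2 := congrFun (congrFun h1 i) j
  exact mul_left_cancel₀ (a := A.det) hd h2

/-- Two matrices which represent the same form are complementary blocks of a unimodular hermitian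
matrix and of its inverse. -/
theorem Represents.exists_complementary (hA : Represents A lam) (hB : Represents B lam) :
    ∃ (F G : Matrix (Fin m) (Fin n) Lam) (Q : Matrix (Fin n) (Fin n) Lam)
      (K : Matrix (Fin n) (Fin m) Lam) (Y : Matrix (Fin m) (Fin m) Lam),
      ct F * G = 1 + Q * A ∧ F * A = B * G ∧ ct Q = Q ∧ F * K = 1 + B * Y := by
  obtain ⟨f, hf⟩ := hA.exists_presents
  obtain ⟨g, hg⟩ := hB.exists_presents
  obtain ⟨hAh, hAd, -⟩ := hA
  obtain ⟨hBh, hBd, -⟩ := hB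
  -- `F` and `K₀` lift the identity of `H` to the two presentations, in opposite directions.
  obtain ⟨F, hF⟩ := exists_matrix_lift hg.surjective f
  obtain ⟨K₀, hK₀⟩ := exists_matrix_lift hf.surjective g
  set A' := A.map (algebraMap Lam Om) with hA'
  set B' := B.map (algebraMap Lam Om) with hB'
  -- Both terms compute the same values of `lam` modulo Λ, so their difference is a matrix over Λ.
  have hR : ∀ i j, ∃ p : Lam, algebraMap Lam Om p =
      ((ct F).map (algebraMap Lam Om) * B'⁻¹ - A'⁻¹ * K₀.map (algebraMap Lam Om)) i j := by
    intro i j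
    rw [← cls_eq_zero, Matrix.sub_apply, map_sub, sub_eq_zero]
    have h1 : pairing A (Pi.single i 1) (K₀ *ᵥ Pi.single j 1) =
        (A'⁻¹ * K₀.map (algebraMap Lam Om)) i j := by
      rw [pairing_single_right, mulVec_single_one]
      rfl
    have h2 : pairing B (F *ᵥ Pi.single i 1) (Pi.single j 1) =
        ((ct F).map (algebraMap Lam Om) * B'⁻¹) i j := by
      rw [← conjOm_pairing hBh hBd, pairing_single_right, mulVec_single_one]
      simp only [mulVec, dotProduct, map_sum, conjOm_mul, conjOm_inv_apply hBh hBd, mul_apply,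
        conjOm_algebraMap, map_apply, ct_apply]
      exact Finset.sum_congr rfl fun k _ => mul_comm _ _
    rw [← h1, ← h2, ← hf.form, ← hg.form, hF, hK₀]
  choose R hR using hR
  have hR' : (Matrix.of R).map (algebraMap Lam Om) =
      (ct F).map (algebraMap Lam Om) * B'⁻¹ - A'⁻¹ * K₀.map (algebraMap Lam Om) := by
    ext i j : 1
    exact hR i j
  -- Adding A·R leaves the induced map to `H` unchanged and turns the congruence into the exact
  -- identity KB = AF*.
  obtain ⟨K, hK⟩ : ∃ K, K = K₀ + A * Matrix.of R := ⟨_, rfl⟩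
  have hKB : K * B = A * ct F := by
    refine Matrix.map_injective (IsFractionRing.injective Lam Om) ?_
    simp only [Matrix.map_mul, hK, Matrix.map_add _ (map_add (algebraMap Lam Om)), hR']
    rw [← hA', ← hB', Matrix.mul_sub, ← Matrix.mul_assoc A' A'⁻¹,
      mul_nonsing_inv _ (isUnit_det_map A hAd), Matrix.one_mul, add_sub_cancel,
      Matrix.mul_assoc, Matrix.mul_assoc, nonsing_inv_mul _ (isUnit_det_map B hBd), Matrix.mul_one]
  have hfK : ∀ v, f (K *ᵥ v) = g v := by
    intro v
    rw [hK, add_mulVec, map_add, hK₀, ← mulVec_mulVec, hf.apply_mulVec, add_zero]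
  obtain ⟨Q', hQ'⟩ := hf.exists_eq_mul (M := K * F - 1) (fun v => by
    rw [sub_mulVec, map_sub, ← mulVec_mulVec, hfK, hF, one_mulVec, sub_self])
  obtain ⟨Y, hY⟩ := hg.exists_eq_mul (M := F * K - 1) (fun v => by
    rw [sub_mulVec, map_sub, ← mulVec_mulVec, hF, hfK, one_mulVec, sub_self])
  have hBG : F * A = B * ct K := by
    have := congrArg ct hKB
    rw [ct_mul, ct_mul, ct_ct] at this
    rw [show ct A = A from hAh, show ct B = B from hBh] at this
    exact this.symm
  have hFG : ct F * ct K = 1 + ct Q' * A := by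
    have := congrArg ct (sub_eq_iff_eq_add.1 hQ')
    rw [ct_mul K F, ct_add (A * Q') 1, ct_mul A, ct_one, show ct A = A from hAh] at this
    rw [this, add_comm]
  -- From KB = AF* and its conjugate transpose, AQ'*A = KBK* - A = (KF - 1)A = AQ'A; then A cancels,
  -- its determinant being non-zero.
  have hQQ : ct Q' = Q' := by
    have h1 : A * (ct Q' * A) = A * (Q' * A) := by
      have e1 : ct Q' * A = ct F * ct K - 1 := by rw [hFG, add_sub_cancel_left]
      rw [e1, ← Matrix.mul_assoc, ← hQ', Matrix.mul_sub, Matrix.sub_mul, ← Matrix.mul_assoc, ← hKB,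
        Matrix.mul_assoc, Matrix.mul_assoc, hBG]
      simp
    have h2 := mul_left_cancel_of_det_ne_zero hAd h1
    have h3 := congrArg ct h2
    rw [ct_mul, ct_mul, ct_ct, show ct A = A from hAh] at h3
    exact (mul_left_cancel_of_det_ne_zero hAd h3).symm
  exact ⟨F, ct K, ct Q', K, Y, hFG, hBG, by rw [hQQ, hQQ], by rw [← hY]; abel⟩

/-- The matrix `M(z)`, for a rectangular matrix `M` over `ℝ[t, t⁻¹]`. -/
def evM {ι κ : Type*} (M : Matrix ι κ Lam) (z : ℂˣ) : Matrix ι κ ℂ := M.map (ev z)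

theorem evM_ct {ι κ : Type*} (M : Matrix ι κ Lam) (z : Circle) :
    evM (ct M) (Circle.toUnits z) = (evM M (Circle.toUnits z))ᴴ := by
  ext i j : 1
  exact ev_conj z _

theorem evM_mul {ι κ τ : Type*} [Fintype κ] (M : Matrix ι κ Lam) (N : Matrix κ τ Lam) (z : ℂˣ) :
    evM (M * N) z = evM M z * evM N z := Matrix.map_mul

theorem evM_one_add {ι : Type*} [DecidableEq ι] (M : Matrix ι ι Lam) (z : ℂˣ) :
    evM (1 + M) z = 1 + evM M z := by
  rw [evM, Matrix.map_add _ (map_add _), Matrix.map_one _ (map_zero _) (map_one _), evM]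

/-- G(z) maps ker A(z) into ker B(z), and it is injective there because (F*G)(z) = 1 + Q(z)A(z) is
the identity on ker A(z). -/
theorem nul_le_of_represents (hA : Represents A lam) (hB : Represents B lam) (z : ℂˣ) :
    nul A z ≤ nul B z := by
  obtain ⟨F, G, Q, -, -, h1, h2, -, -⟩ := hA.exists_complementary hB
  have h1 := congrArg (fun M => evM M z) h1
  have h2 := congrArg (fun M => evM M z) h2
  simp only [evM_mul, evM_one_add] at h1 h2
  have hmem : ∀ c ∈ LinearMap.ker (evalAt A z).mulVecLin,
      (evM G z).mulVecLin c ∈ LinearMap.ker (evalAt B z).mulVecLin := by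
    intro c hc
    have hc : evM A z *ᵥ c = 0 := hc
    change evM B z *ᵥ (evM G z *ᵥ c) = 0
    rw [mulVec_mulVec, ← h2, ← mulVec_mulVec, hc, mulVec_zero]
  refine LinearMap.finrank_le_finrank_of_injective (f := (evM G z).mulVecLin.restrict hmem) ?_
  rw [← LinearMap.ker_eq_bot, Submodule.eq_bot_iff]
  rintro ⟨c, hc⟩ h0
  have h0 : evM G z *ᵥ c = 0 := congrArg Subtype.val h0
  have hc' : evM A z *ᵥ c = 0 := hc
  have h3 : (evM (ct F) z * evM G z) *ᵥ c = 0 := by rw [← mulVec_mulVec, h0, mulVec_zero]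
  rw [h1, add_mulVec, one_mulVec, ← mulVec_mulVec, hc', mulVec_zero, add_zero] at h3
  exact Subtype.ext h3

theorem nul_eq_of_represents (hA : Represents A lam) (hB : Represents B lam) (z : ℂˣ) :
    nul A z = nul B z :=
  le_antisymm (nul_le_of_represents hA hB z) (nul_le_of_represents hB hA z)

theorem continuous_ev (p : Lam) : Continuous fun z : Circle => ev (Circle.toUnits z) p := by
  induction p using LaurentPolynomial.induction_on' with
  | add p q hp hq => exact (hp.add hq).congr fun z => (map_add _ _ _).symm
  | C_mul_T n a =>
    have h : ∀ z : Circle, ev (Circle.toUnits z) (LaurentPolynomial.C a * LaurentPolynomial.T n) =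
        a * ((z ^ n : Circle) : ℂ) := by
      intro z
      rw [map_mul, ev_C, ev_T, ← map_zpow, Circle.toUnits_apply, Units.val_mk0]
    simp only [h]
    exact continuous_const.mul (continuous_subtype_val.comp (continuous_zpow n))

theorem isHermitian_evalAt (hA : IsHerm A) (z : Circle) :
    (evalAt A (Circle.toUnits z)).IsHermitian := by
  have h := evM_ct A z
  rw [show ct A = A from hA] at h
  exact h.symm

theorem nulDim_eq_zero_of_det_ne_zero {ι : Type*} [Fintype ι] [DecidableEq ι] {M : Matrix ι ι ℂ}
    (h : M.det ≠ 0) : nulDim M = 0 := by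
  rw [nulDim, LinearMap.ker_eq_bot'.2 fun v hv => ?_, finrank_bot]
  by_contra h0
  exact h (exists_mulVec_eq_zero_iff.1 ⟨v, h0, hv⟩)

/-- The unimodular block matrix W has signature sign B(z) - sign A(z) at each point of the circle.
Being non-singular on the connected circle, it has constant signature, so subtracting the value at 1
gives σ_A = σ_B. -/
theorem sig_eq_of_represents (hA : Represents A lam) (hB : Represents B lam) (z : Circle) :
    sig A z = sig B z := by
  obtain ⟨F, G, Q, K, Y, h1, h2, h3, h4⟩ := hA.exists_complementary hB
  let W : Circle → Matrix (Fin n ⊕ Fin m) (Fin n ⊕ Fin m) ℂ := fun z =>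
    fromBlocks (evM Q (Circle.toUnits z)) (evM F (Circle.toUnits z))ᴴ (evM F (Circle.toUnits z))
      (evM B (Circle.toUnits z))
  have e1 : ∀ z : Circle, (evM F (Circle.toUnits z))ᴴ * evM G (Circle.toUnits z) =
      1 + evM Q (Circle.toUnits z) * evM A (Circle.toUnits z) := fun z => by
    rw [← evM_ct, ← evM_mul, h1, evM_one_add, evM_mul]
  have e2 : ∀ z : Circle, evM F (Circle.toUnits z) * evM A (Circle.toUnits z) =
      evM B (Circle.toUnits z) * evM G (Circle.toUnits z) := fun z => by
    rw [← evM_mul, h2, evM_mul]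
  have e4 : ∀ z : Circle, evM F (Circle.toUnits z) * evM K (Circle.toUnits z) =
      1 + evM B (Circle.toUnits z) * evM Y (Circle.toUnits z) := fun z => by
    rw [← evM_mul, h4, evM_one_add, evM_mul]
  have hQ : ∀ z : Circle, (evM Q (Circle.toUnits z)).IsHermitian := fun z => by
    have h := evM_ct Q z
    rw [h3] at h
    exact h.symm
  have hnul : ∀ z, nulDim (W z) = 0 := by
    intro z
    refine nulDim_eq_zero_of_det_ne_zero fun h0 => ?_
    -- This product is unitriangular, which proves W(z) invertible.
    have h5 : W z * fromBlocks (-evM A (Circle.toUnits z)) (evM K (Circle.toUnits z))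
        (evM G (Circle.toUnits z)) (-evM Y (Circle.toUnits z)) = fromBlocks 1
          (evM Q (Circle.toUnits z) * evM K (Circle.toUnits z) -
            (evM F (Circle.toUnits z))ᴴ * evM Y (Circle.toUnits z)) 0 1 := by
      rw [fromBlocks_multiply]
      congr 1
      · rw [e1, Matrix.mul_neg]; abel
      · rw [Matrix.mul_neg]; abel
      · rw [Matrix.mul_neg, e2]; abel
      · rw [Matrix.mul_neg, e4]; abel
    have h6 := congrArg det h5
    rw [det_mul, h0, zero_mul, det_fromBlocks_zero₂₁, det_one, det_one, one_mul] at h6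
    exact zero_ne_one h6
  have hcont : Continuous W := by
    have hev : ∀ {ι κ : Type} (M : Matrix ι κ Lam),
        Continuous fun z : Circle => evM M (Circle.toUnits z) := fun M =>
      continuous_matrix fun i j => continuous_ev (M i j)
    exact (hev Q).matrix_fromBlocks (hev F).matrix_conjTranspose (hev F) (hev B)
  have hB' := fun z => isHermitian_evalAt hB.1 z
  have hconst := sgnt_eq_of_preconnected hcont
    (fun z => IsHermitian.fromBlocks (hQ z) (by simp) (hB' z)) hnul z 1
  have hsg : ∀ z, sgnt (W z) =
      sgnt (evalAt B (Circle.toUnits z)) - sgnt (evalAt A (Circle.toUnits z)) := fun z =>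
    sgnt_complementary (isHermitian_evalAt hA.1 z) (hB' z) (hQ z) (e1 z) (e2 z) (hnul z)
      (nul_eq_of_represents hA hB _)
  rw [hsg, hsg, map_one] at hconst
  simp only [sig, sign_eq_sgnt]
  omega

theorem muMat_eq_of_represents (hA : Represents A lam) (hB : Represents B lam) :
    muMat A = muMat B := by
  simp only [muMat, nul_eq_of_represents hA hB, sig_eq_of_represents hA hB]

theorem etaMat_eq_of_represents (hA : Represents A lam) (hB : Represents B lam) :
    etaMat A = etaMat B := by
  simp only [etaMat, nul_eq_of_represents hA hB]

theorem Represents.muMat_eq (hA : Represents A lam) : muMat A = mu lam := by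
  have h : ∃ B : (n : ℕ) × Matrix (Fin n) (Fin n) Lam, Represents B.2 lam := ⟨⟨n, A⟩, hA⟩
  rw [mu, dif_pos h]
  exact muMat_eq_of_represents hA h.choose_spec

theorem Represents.etaMat_eq (hA : Represents A lam) : etaMat A = eta lam := by
  have h : ∃ B : (n : ℕ) × Matrix (Fin n) (Fin n) Lam, Represents B.2 lam := ⟨⟨n, A⟩, hA⟩
  rw [eta, dif_pos h]
  exact etaMat_eq_of_represents hA h.choose_spec

end Independence

/-! ### Cyclic forms -/

section Cyclic

open Polynomial

/-- The class of `1 / d` in `ℝ(t) / ℝ[t, t⁻¹]`. -/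
def recip (d : ℝ[X]) : OmLam := cls (algebraMap Lam Om (ofPoly d))⁻¹

theorem algebraMap_ofPoly_ne_zero {d : ℝ[X]} (hd : d ≠ 0) : algebraMap Lam Om (ofPoly d) ≠ 0 :=
  (map_ne_zero_iff _ (IsFractionRing.injective Lam Om)).2 (ofPoly_ne_zero hd)

theorem smul_recip_eq_zero {d : ℝ[X]} (hd : d ≠ 0) {p : Lam} :
    p • recip d = 0 ↔ ofPoly d ∣ p := by
  have h0 := algebraMap_ofPoly_ne_zero hd
  rw [recip, ← map_smul, cls_eq_zero, Algebra.smul_def]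
  constructor
  · rintro ⟨r, hr⟩
    refine ⟨r, IsFractionRing.injective Lam Om ?_⟩
    rw [map_mul, hr]
    field_simp
  · rintro ⟨r, rfl⟩
    refine ⟨r, ?_⟩
    rw [map_mul]
    field_simp

theorem ofPoly_smul_recip_self {d : ℝ[X]} (hd : d ≠ 0) : ofPoly d • recip d = 0 :=
  (smul_recip_eq_zero hd).2 dvd_rfl

theorem ofPoly_smul_recip_mul {a : ℝ[X]} (ha : a ≠ 0) (b : ℝ[X]) :
    ofPoly a • recip (a * b) = recip b := by
  have h0 := algebraMap_ofPoly_ne_zero ha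
  rw [recip, recip, ← map_smul, Algebra.smul_def, map_mul ofPoly,
    map_mul (algebraMap Lam Om), mul_inv, mul_inv_cancel_left₀ h0]

theorem recip_C_mul {ε : ℝ} (hε : ε ≠ 0) (b : ℝ[X]) :
    recip (C ε * b) = ofPoly (C ε⁻¹) • recip b := by
  rw [← ofPoly_smul_recip_mul (C_ne_zero.2 hε) b, smul_smul, ← map_mul, ← C_mul,
    inv_mul_cancel₀ hε, C_1, map_one, one_smul]

theorem exists_smul_recip_eq {d : ℝ[X]} (hd : d ≠ 0) {ξ : OmLam} (h : ofPoly d • ξ = 0) :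
    ∃ p : Lam, ξ = p • recip d := by
  obtain ⟨x, rfl⟩ := cls_surjective ξ
  rw [← map_smul, cls_eq_zero] at h
  obtain ⟨p, hp⟩ := h
  refine ⟨p, ?_⟩
  have h0 := algebraMap_ofPoly_ne_zero hd
  rw [recip, ← map_smul, Algebra.smul_def, hp, Algebra.smul_def, mul_comm, inv_mul_cancel_left₀ h0]

theorem conjOmLam_recip {d : ℝ[X]} (hd : d ≠ 0) : conjOmLam (recip d) = recip d := by
  have h0 := algebraMap_ofPoly_ne_zero hd
  have h : conjOm (algebraMap Lam Om (ofPoly d)) = algebraMap Lam Om (ofPoly d) := by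
    rw [conjOm_algebraMap, conj_ofPoly]
  rw [recip, conjOmLam_cls]
  congr 1
  refine eq_inv_of_mul_eq_one_left ?_
  calc _ = conjOm (algebraMap Lam Om (ofPoly d))⁻¹ * conjOm (algebraMap Lam Om (ofPoly d)) := by
        rw [h]
    _ = 1 := by rw [← conjOm_mul, inv_mul_cancel₀ h0, conjOm_one]

/-- A symmetric unit modulo `q` is a constant times the inverse of a norm, if it has the sign of
this constant at the zeros of `q` in `[-2, 2]`. -/
theorem exists_dvd_mul_conj_mul_sub {u q : ℝ[X]} (huq : IsCoprime u q) {ε : ℝ} (hε : ε ≠ 0)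
    (h : ∀ x ∈ Set.Icc (-2 : ℝ) 2, q.IsRoot x → 0 < ε * u.eval x) :
    ∃ w : Lam, ofPoly q ∣ w * conj w * ofPoly u - ofPoly (C ε⁻¹) := by
  -- `v` inverts u modulo q, so at the zeros of q in the interval ε⁻¹v is positive and hence a norm
  -- modulo q.
  obtain ⟨v, r, hvr⟩ := huq
  obtain ⟨w, hw⟩ := exists_dvd_mul_conj_sub (f := q) (u := C ε⁻¹ * v) (fun x hx hq => by
    have h1 := congrArg (eval x) hvr
    rw [eval_add, eval_mul, eval_mul, hq.eq_zero, mul_zero, add_zero, eval_one] at h1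
    have h2 := h x hx hq
    rw [eval_mul, eval_C]
    have h3 : (ε * u.eval x) * (ε⁻¹ * v.eval x) = 1 := by
      field_simp
      linarith
    exact (pos_iff_pos_of_mul_pos (by rw [h3]; exact one_pos)).1 h2)
  refine ⟨w, ?_⟩
  have e : w * conj w * ofPoly u - ofPoly (C ε⁻¹) =
      (w * conj w - ofPoly (C ε⁻¹ * v)) * ofPoly u - ofPoly q * (ofPoly (C ε⁻¹) * ofPoly r) := by
    have := congrArg ofPoly hvr
    rw [map_add, map_mul, map_mul, map_one] at this
    rw [map_mul]
    linear_combination ofPoly (C ε⁻¹) * this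
  rw [e]
  exact dvd_sub (hw.mul_right _) (dvd_mul_right _ _)

variable {H : Type*} [AddCommGroup H] [Module Lam H] {lam : Form H}

theorem form_smul_left (lam : Form H) (p : Lam) (a b : H) : lam (p • a) b = conj p • lam a b := by
  rw [map_smulₛₗ, LinearMap.smul_apply]

theorem form_add_left (lam : Form H) (a a' b : H) : lam (a + a') b = lam a b + lam a' b := by
  rw [map_add, LinearMap.add_apply]

theorem form_ofPoly_smul_left (lam : Form H) (p : ℝ[X]) (a b : H) :
    lam (ofPoly p • a) b = ofPoly p • lam a b := by
  rw [form_smul_left, conj_ofPoly]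

theorem IsNondeg.eq_zero_of_right (hl : IsNondeg lam) {a b : H} (h : lam a b = 0) :
    lam b a = 0 := by
  rw [hl.hermitian, h, map_zero]

theorem isCoprime_ofPoly {a b : ℝ[X]} (h : IsCoprime a b) : IsCoprime (ofPoly a) (ofPoly b) := by
  obtain ⟨r, s, h⟩ := h
  exact ⟨ofPoly r, ofPoly s, by rw [← map_mul, ← map_mul, ← map_add, h, map_one]⟩

/-- Two orthogonal cyclic forms of coprime orders with compatible signs are combined to one. -/
theorem IsNondeg.exists_absorb (hl : IsNondeg lam) {a b : ℝ[X]} (ha : a ≠ 0) (hb : b ≠ 0)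
    (hab : IsCoprime a b) {ε : ℝ} (hε : ε ≠ 0)
    (h1 : ∀ x ∈ Set.Icc (-2 : ℝ) 2, a.IsRoot x → 0 < ε * b.eval x)
    (h2 : ∀ x ∈ Set.Icc (-2 : ℝ) 2, b.IsRoot x → 0 < ε * a.eval x)
    {y z : H} (hy : lam y y = recip a) (hz : lam z z = recip b) (hyz : lam y z = 0)
    (hay : ofPoly a • y = 0) (hbz : ofPoly b • z = 0) :
    ∃ x : H, lam x x = recip (C ε * (a * b)) ∧
      Submodule.span Lam {x} = Submodule.span Lam {y, z} := by
  obtain ⟨w, hw⟩ := exists_dvd_mul_conj_mul_sub hab.symm hε h1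
  obtain ⟨v, hv⟩ := exists_dvd_mul_conj_mul_sub hab hε h2
  have hzy := hl.eq_zero_of_right hyz
  have hE : ofPoly (C ε) * ofPoly (C ε⁻¹) = 1 := by
    rw [← map_mul, ← C_mul, mul_inv_cancel₀ hε, C_1, map_one]
  -- The value at wy + vz is (ww̅b + vv̅a)/(ab). The numerator is ε⁻¹ modulo a and modulo b, hence
  -- modulo ab.
  refine ⟨w • y + v • z, ?_, le_antisymm ?_ ?_⟩
  · have e1 : recip a = ofPoly b • recip (a * b) := by
      rw [mul_comm a b, ofPoly_smul_recip_mul hb]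
    have e2 : recip b = ofPoly a • recip (a * b) := by
      rw [ofPoly_smul_recip_mul ha]
    rw [form_add_left, map_add, map_add, form_smul_left, form_smul_left,
      form_smul_left, form_smul_left, map_smul, map_smul, map_smul, map_smul, hy, hz, hyz, hzy,
      recip_C_mul hε, e1, e2, ← sub_eq_zero]
    simp only [smul_zero, add_zero, zero_add, smul_smul]
    rw [← add_smul, ← sub_smul, smul_recip_eq_zero (mul_ne_zero ha hb), map_mul ofPoly]
    refine (isCoprime_ofPoly hab).mul_dvd ?_ ?_
    · have : conj w * (w * ofPoly b) + conj v * (v * ofPoly a) - ofPoly (C ε⁻¹) =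
        (w * conj w * ofPoly b - ofPoly (C ε⁻¹)) + ofPoly a * (v * conj v) := by ring
      rw [this]
      exact dvd_add hw (dvd_mul_right _ _)
    · have : conj w * (w * ofPoly b) + conj v * (v * ofPoly a) - ofPoly (C ε⁻¹) =
        (v * conj v * ofPoly a - ofPoly (C ε⁻¹)) + ofPoly b * (w * conj w) := by ring
      rw [this]
      exact dvd_add hv (dvd_mul_right _ _)
  · rw [Submodule.span_singleton_le_iff_mem, Submodule.mem_span_pair]
    exact ⟨w, v, rfl⟩
  · obtain ⟨w', hw'⟩ := hw
    obtain ⟨v', hv'⟩ := hv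
    rw [Submodule.span_le]
    rintro _ (rfl | rfl)
    · refine Submodule.mem_span_singleton.2 ⟨ofPoly (C ε) * conj w * ofPoly b, ?_⟩
      have e : ofPoly (C ε) * conj w * ofPoly b * w = 1 + ofPoly (C ε) * w' * ofPoly a := by
        linear_combination ofPoly (C ε) * hw' + hE
      have e' : ofPoly (C ε) * conj w * ofPoly b * v =
        ofPoly (C ε) * conj w * v * ofPoly b := by ring
      rw [smul_add, smul_smul, smul_smul, e, e', add_smul, mul_smul _ (ofPoly a), hay, mul_smul _ (ofPoly b), hbz]
      simp
    · refine Submodule.mem_span_singleton.2 ⟨ofPoly (C ε) * conj v * ofPoly a, ?_⟩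
      have e : ofPoly (C ε) * conj v * ofPoly a * v = 1 + ofPoly (C ε) * v' * ofPoly b := by
        linear_combination ofPoly (C ε) * hv' + hE
      have e' : ofPoly (C ε) * conj v * ofPoly a * w =
        ofPoly (C ε) * conj v * w * ofPoly a := by ring
      rw [smul_add, smul_smul, smul_smul, e, e', add_smul, mul_smul _ (ofPoly a), hay, mul_smul _ (ofPoly b), hbz]
      simp

/-- The orders of the primary cyclic forms: signed powers of an irreducible polynomial, which is
positive on `[-2, 2]` or has a zero in the interior of this interval. -/
def IsPrimary (d : ℝ[X]) : Prop :=
  (∃ (ε c : ℝ) (k : ℕ), ε ≠ 0 ∧ c ∈ Set.Ioo (-2 : ℝ) 2 ∧ k ≠ 0 ∧ d = C ε * (X - C c) ^ k) ∨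
  ((∃ (ε : ℝ) (π : ℝ[X]) (k : ℕ), ε ≠ 0 ∧ Irreducible π ∧ k ≠ 0 ∧ d = C ε * π ^ k) ∧
    ∀ x ∈ Set.Icc (-2 : ℝ) 2, 0 < d.eval x)

theorem IsPrimary.ne_zero {d : ℝ[X]} (h : IsPrimary d) : d ≠ 0 := by
  rcases h with ⟨ε, c, k, hε, -, -, rfl⟩ | ⟨⟨ε, π, k, hε, hπ, -, rfl⟩, -⟩
  · exact mul_ne_zero (C_ne_zero.2 hε) (pow_ne_zero _ (X_sub_C_ne_zero c))
  · exact mul_ne_zero (C_ne_zero.2 hε) (pow_ne_zero _ hπ.ne_zero)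

theorem IsPrimary.not_isUnit {d : ℝ[X]} (h : IsPrimary d) : ¬ IsUnit d := by
  rcases h with ⟨ε, c, k, hε, -, hk, rfl⟩ | ⟨⟨ε, π, k, hε, hπ, hk, rfl⟩, -⟩ <;> intro h <;>
    have h := (isUnit_pow_iff hk).1 (isUnit_of_mul_isUnit_right h)
  · exact (irreducible_X_sub_C c).not_isUnit h
  · exact hπ.not_isUnit h

theorem recip_ne_zero {d : ℝ[X]} (h0 : d ≠ 0) (h : ¬ IsUnit d) : recip d ≠ 0 := by
  intro h1
  rw [← one_smul Lam (recip d), smul_recip_eq_zero h0] at h1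
  have hdeg : d.degree ≠ 0 := fun hd => h (isUnit_iff_degree_eq_zero.2 hd)
  obtain ⟨w, hw⟩ := IsAlgClosed.exists_aeval_eq_zero ℂ d hdeg
  obtain ⟨z, hz⟩ := exists_add_inv_eq w
  obtain ⟨r, hr⟩ := h1
  have h2 := congrArg (ev z) hr
  rw [map_one, map_mul, ev_ofPoly, hz, hw, zero_mul] at h2
  exact one_ne_zero h2

/-- `t - t⁻¹`. -/
def tau : Lam := LaurentPolynomial.T 1 - LaurentPolynomial.T (-1)

theorem conj_tau : conj tau = -tau := by
  rw [tau, map_sub, conj_T, conj_T, neg_neg, neg_sub]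

/-- Polarization, and the place where injectivity of τ = t - t⁻¹ enters. If gλ(z, z) vanished on K,
then g(λ(y, w) + λ(w, y)) = 0. Replacing w by τw, with τ̅ = -τ, gives τg(λ(y, w) - λ(w, y)) = 0.
Adding τ times the first, 2τgλ(y, w) = 0, so τgw is in the radical of K and gw = 0 for all w. -/
theorem exists_smul_form_self_ne_zero (htau : ∀ h : H, tau • h = 0 → h = 0) {K : Submodule Lam H}
    (hK : ∀ y ∈ K, (∀ w ∈ K, lam w y = 0) → y = 0) {g : ℝ[X]}
    (hg : ∃ y ∈ K, ofPoly g • y ≠ 0) : ∃ z ∈ K, ofPoly g • lam z z ≠ 0 := by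
  by_contra! hcon
  have hpol : ∀ y ∈ K, ∀ w ∈ K, ofPoly g • (lam y w + lam w y) = 0 := by
    intro y hy w hw
    have h1 := hcon (y + w) (K.add_mem hy hw)
    rw [form_add_left, map_add, map_add, smul_add, smul_add, smul_add, hcon y hy,
      hcon w hw] at h1
    rw [smul_add, ← h1]
    abel
  obtain ⟨w, hw, hgw⟩ := hg
  refine hgw (htau _ (hK _ (K.smul_mem _ (K.smul_mem _ hw)) fun y hy => ?_))
  have h1 := congrArg (fun ξ => tau • ξ) (hpol y hy w hw)
  have h2 := hpol y hy (tau • w) (K.smul_mem _ hw)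
  rw [form_smul_left, map_smul, conj_tau, neg_smul, ← sub_eq_add_neg, ← smul_sub] at h2
  simp only [smul_zero] at h1
  have h3 : (2 : Lam) • (tau • ofPoly g • lam y w) = 0 := by
    have : (2 : Lam) • (tau • ofPoly g • lam y w) =
        tau • ofPoly g • (lam y w + lam w y) + ofPoly g • tau • (lam y w - lam w y) := by
      simp only [smul_add, smul_sub, two_smul]
      rw [smul_comm tau (ofPoly g) (lam w y), smul_comm tau (ofPoly g) (lam y w)]
      abel
    rw [this, h1, h2, add_zero]
  rw [map_smul, map_smul]
  have h4 : (LaurentPolynomial.C (1 / 2) * 2 : Lam) = 1 := by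
    have : (2 : Lam) = LaurentPolynomial.C 2 := by rw [map_ofNat]
    rw [this, ← map_mul]
    norm_num
  rw [← one_smul Lam (tau • ofPoly g • lam y w), ← h4, mul_smul, h3, smul_zero]

theorem exists_ofPoly_annihilates {r : Lam} (hr : r ≠ 0) :
    ∃ f : ℝ[X], f ≠ 0 ∧ r ∣ ofPoly f := by
  obtain ⟨f, hf⟩ := exists_ofPoly_eq (p := r * conj r) (by rw [map_mul, conj_conj, mul_comm])
  refine ⟨f, ?_, conj r, hf⟩
  rintro rfl
  rw [map_zero] at hf
  rcases mul_eq_zero.1 hf.symm with h | h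
  · exact hr h
  · exact hr (by rw [← conj_conj r, h, map_zero])

/-- Take z with gλ(z, z) ≠ 0 and write g = πᵏh with h prime to π. Then hz is killed by πᵏ⁺¹, whereas
πᵏ does not kill λ(hz, hz); so this value has exact denominator πᵏ⁺¹. -/
theorem exists_form_self_eq_smul_recip (hl : IsNondeg lam)
    (htau : ∀ h : H, tau • h = 0 → h = 0) {K : Submodule Lam H}
    (hK : ∀ y ∈ K, (∀ w ∈ K, lam w y = 0) → y = 0) {f π : ℝ[X]} (hf : f ≠ 0) (hπ : Irreducible π)
    (hfK : ∀ y ∈ K, ofPoly f • y = 0) {g : ℝ[X]} (hfg : f = π * g)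
    (hg : ∃ y ∈ K, ofPoly g • y ≠ 0) :
    ∃ z ∈ K, ∃ (k : ℕ) (u : ℝ[X]), k ≠ 0 ∧ IsCoprime u π ∧ ofPoly (π ^ k) • z = 0 ∧
      lam z z = ofPoly u • recip (π ^ k) := by
  obtain ⟨z, hz, hgz⟩ := exists_smul_form_self_ne_zero htau hK hg
  have hg0 : g ≠ 0 := by rintro rfl; exact hf (by rw [hfg, mul_zero])
  obtain ⟨k, h, hh, hgk⟩ := WfDvdMonoid.max_power_factor hg0 hπ
  have hcop : IsCoprime π h := (hπ.coprime_iff_not_dvd).2 hh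
  have hfk : f = π ^ (k + 1) * h := by rw [hfg, hgk]; ring
  have hz1 : ofPoly (π ^ (k + 1)) • ofPoly h • z = 0 := by
    rw [smul_smul, ← map_mul, ← hfk, hfK z hz]
  have hξ : ofPoly (π ^ k) • lam (ofPoly h • z) (ofPoly h • z) ≠ 0 := by
    intro h0
    rw [form_ofPoly_smul_left, map_smul, smul_smul, ← map_mul, ← hgk] at h0
    rw [smul_comm] at h0
    obtain ⟨a, b, hab⟩ := hcop
    refine hgz ?_
    have h1 : ofPoly π • ofPoly g • lam z z = 0 := by
      rw [smul_smul, ← map_mul, ← hfg, ← map_smul, hfK z hz, map_zero]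
    rw [← one_smul Lam (ofPoly g • lam z z), ← map_one ofPoly, ← hab, map_add, map_mul, map_mul,
      add_smul, mul_smul, mul_smul, h1, h0, smul_zero, smul_zero, add_zero]
  set y := ofPoly h • z with hy
  have hq0 : π ^ (k + 1) ≠ 0 := pow_ne_zero _ hπ.ne_zero
  obtain ⟨p, hp⟩ := exists_smul_recip_eq hq0 (ξ := lam y y) (by rw [← map_smul, hz1, map_zero])
  have hconj : (conj p - p) • recip (π ^ (k + 1)) = 0 := by
    rw [sub_smul, sub_eq_zero, ← hp]
    conv_rhs => rw [hl.hermitian, hp, map_smulₛₗ, conjOmLam_recip hq0]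
  rw [smul_recip_eq_zero hq0] at hconj
  have h4 : (LaurentPolynomial.C (1 / 2) * 2 : Lam) = 1 := by
    have : (2 : Lam) = LaurentPolynomial.C 2 := by rw [map_ofNat]
    rw [this, ← map_mul]
    norm_num
  -- Hermitian symmetry makes p and p̅ congruent modulo πᵏ⁺¹, so the numerator can be replaced by
  -- the symmetric element (p + p̅)/2.
  obtain ⟨u, hu⟩ := exists_ofPoly_eq (p := LaurentPolynomial.C (1 / 2) * (p + conj p)) (by
    rw [map_mul, map_add, conj_conj, conj_C, add_comm])
  have hpu : lam y y = ofPoly u • recip (π ^ (k + 1)) := by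
    rw [hp, ← sub_eq_zero, ← sub_smul, smul_recip_eq_zero hq0, hu]
    have : p - LaurentPolynomial.C (1 / 2) * (p + conj p) =
        (conj p - p) * -LaurentPolynomial.C (1 / 2) := by linear_combination - p * h4
    rw [this]
    exact hconj.mul_right _
  refine ⟨y, K.smul_mem _ hz, k + 1, u, by omega, ?_, hz1, hpu⟩
  refine ((hπ.coprime_iff_not_dvd).2 ?_).symm
  rintro ⟨v, rfl⟩
  refine hξ ?_
  rw [hpu, smul_smul, smul_recip_eq_zero hq0, ← map_mul]
  exact map_dvd ofPoly ⟨v, by ring⟩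

theorem exists_form_self_eq_recip {K : Submodule Lam H} {z : H}
    (hz : z ∈ K) {u q : ℝ[X]} (hq : q ≠ 0) (huq : IsCoprime u q) (hqz : ofPoly q • z = 0)
    (hzz : lam z z = ofPoly u • recip q) {ε : ℝ} (hε : ε ≠ 0)
    (h : ∀ x ∈ Set.Icc (-2 : ℝ) 2, q.IsRoot x → 0 < ε * u.eval x) :
    ∃ y ∈ K, lam y y = recip (C ε * q) ∧ ofPoly (C ε * q) • y = 0 := by
  obtain ⟨w, hw⟩ := exists_dvd_mul_conj_mul_sub huq hε h
  refine ⟨w • z, K.smul_mem _ hz, ?_, ?_⟩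
  · rw [form_smul_left, map_smul, hzz, recip_C_mul hε, ← sub_eq_zero, smul_smul, smul_smul,
      ← sub_smul, smul_recip_eq_zero hq]
    rwa [mul_comm (conj w)]
  · rw [map_mul, mul_smul, smul_comm _ w z, hqz, smul_zero, smul_zero]

theorem exists_pos_mul_eval {q : ℝ[X]} (h : ∀ x ∈ Set.Icc (-2 : ℝ) 2, ¬ q.IsRoot x) :
    ∃ ε : ℝ, ε ≠ 0 ∧ ∀ x ∈ Set.Icc (-2 : ℝ) 2, 0 < ε * q.eval x := by
  refine ⟨q.eval 0, fun h0 => h 0 (by norm_num) h0, fun x hx => ?_⟩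
  by_contra hneg
  rw [not_lt] at hneg
  have h0 : (0 : ℝ) ∈ Set.Icc (-2 : ℝ) 2 := by norm_num
  have hconn : IsPreconnected (Set.Icc (-2 : ℝ) 2) := isPreconnected_Icc
  have hc : ContinuousOn (fun x => q.eval 0 * q.eval x) (Set.Icc (-2 : ℝ) 2) :=
    (continuous_const.mul q.continuous).continuousOn
  obtain ⟨y, hy, hy0⟩ := hconn.intermediate_value hx h0 hc ⟨hneg, mul_self_nonneg _⟩
  rcases mul_eq_zero.1 hy0 with h1 | h1
  · exact h 0 h0 h1
  · exact h y hy h1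

/-- A non-zero form with trivial radical contains a primary cyclic form. -/
theorem exists_primary (hl : IsNondeg lam) (htau : ∀ h : H, tau • h = 0 → h = 0) {r : Lam}
    (hr0 : r ≠ 0) (hr : ∀ h : H, r • h = 0) {K : Submodule Lam H} (hK0 : K ≠ ⊥)
    (hK : ∀ y ∈ K, (∀ w ∈ K, lam w y = 0) → y = 0) :
    ∃ z ∈ K, ∃ d : ℝ[X], IsPrimary d ∧ lam z z = recip d ∧ ofPoly d • z = 0 := by
  classical
  have hex : ∃ n : ℕ, ∃ f : ℝ[X], f ≠ 0 ∧ f.natDegree = n ∧ ∀ y ∈ K, ofPoly f • y = 0 := by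
    obtain ⟨f, hf, s, hs⟩ := exists_ofPoly_annihilates hr0
    exact ⟨_, f, hf, rfl, fun y _ => by rw [hs, mul_comm, mul_smul, hr, smul_zero]⟩
  -- `f` is an annihilator of K of least degree among the symmetric ones.
  obtain ⟨f, hf, hfn, hfK⟩ := Nat.find_spec hex
  obtain ⟨y₀, hy₀, hy₀0⟩ := (Submodule.ne_bot_iff K).1 hK0
  have hunit : ¬ IsUnit f := by
    intro hu
    obtain ⟨v, hv⟩ := hu.exists_right_inv
    refine hy₀0 ?_
    rw [← one_smul Lam y₀, ← map_one ofPoly, ← hv, mul_comm, map_mul, mul_smul, hfK y₀ hy₀,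
      smul_zero]
  -- dividing by an irreducible factor, one gets a polynomial which does not annihilate
  have hmin : ∀ π g : ℝ[X], Irreducible π → f = π * g → ∃ y ∈ K, ofPoly g • y ≠ 0 := by
    intro π g hπ hfg
    by_contra! hcon
    have hg0 : g ≠ 0 := by rintro rfl; exact hf (by rw [hfg, mul_zero])
    have h1 := Nat.find_min' hex ⟨g, hg0, rfl, hcon⟩
    rw [← hfn, hfg, natDegree_mul hπ.ne_zero hg0] at h1
    have := hπ.natDegree_pos
    omega
  by_cases hroot : ∃ c ∈ Set.Icc (-2 : ℝ) 2, f.IsRoot c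
  · obtain ⟨c, hc, hfc⟩ := hroot
    obtain ⟨g, hg⟩ := dvd_iff_isRoot.2 hfc
    obtain ⟨y, hy, hgy⟩ := hmin _ g (irreducible_X_sub_C c) hg
    have h1 : ofPoly (X - C c) • ofPoly g • y = 0 := by
      rw [smul_smul, ← map_mul, ← hg, hfK y hy]
    have hT : (LaurentPolynomial.T 1 * LaurentPolynomial.T (-1) : Lam) = 1 := by
      rw [← LaurentPolynomial.T_add]; simp
    -- The zeros c = ±2 are excluded: there X - c divides X² - 4 = τ², and τ is injective.
    have hne : ∀ s : ℝ, s ^ 2 = 1 → c ≠ 2 * s := by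
      intro s hs hcs
      have h2 : tau * tau = (ofPoly (X + C c)) * ofPoly (X - C c) := by
        rw [← map_mul]
        have : ((X + C c) * (X - C c) : ℝ[X]) = X ^ 2 - C 4 := by
          rw [show (4 : ℝ) = c ^ 2 by rw [hcs]; linarith, map_pow]; ring
        rw [this, map_sub, map_pow, ofPoly_X, ofPoly_C, tau]
        have h4 : (LaurentPolynomial.C 4 : Lam) = 4 := by rw [map_ofNat]
        rw [h4]
        linear_combination - 4 * hT
      refine hgy (htau _ (htau _ ?_))
      rw [smul_smul, h2, mul_smul, h1, smul_zero]
    have hc' : c ∈ Set.Ioo (-2 : ℝ) 2 := by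
      refine ⟨lt_of_le_of_ne hc.1 ?_, lt_of_le_of_ne hc.2 ?_⟩
      · have := hne (-1) (by norm_num)
        intro h; apply this; linarith
      · have := hne 1 (by norm_num)
        intro h; apply this; linarith
    obtain ⟨z, hz, k, u, hk, huπ, hqz, hzz⟩ := exists_form_self_eq_smul_recip hl htau hK hf
      (irreducible_X_sub_C c) hfK hg ⟨y, hy, hgy⟩
    have huc : u.eval c ≠ 0 := by
      intro h0
      exact (irreducible_X_sub_C c).not_isUnit
        (huπ.isUnit_of_dvd' (dvd_iff_isRoot.2 h0) dvd_rfl)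
    -- The only zero of (X - c)ᵏ is c, so u(c) itself serves as the constant ε.
    obtain ⟨y, hy, hyy, hqy⟩ := exists_form_self_eq_recip hz (pow_ne_zero k (X_sub_C_ne_zero c))
      huπ.pow_right hqz hzz huc (fun x _ hx => by
        have : x = c := by
          rw [IsRoot.def, eval_pow, eval_sub, eval_X, eval_C] at hx
          exact sub_eq_zero.1 (pow_eq_zero_iff hk |>.1 hx)
        rw [this]
        exact mul_self_pos.2 huc)
    exact ⟨y, hy, _, Or.inl ⟨_, c, k, huc, hc', hk, rfl⟩, hyy, hqy⟩
  · obtain ⟨π, hπ, g, hg⟩ := WfDvdMonoid.exists_irreducible_factor hunit hf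
    obtain ⟨z, hz, k, u, hk, huπ, hqz, hzz⟩ := exists_form_self_eq_smul_recip hl htau hK hf
      hπ hfK hg (hmin π g hπ hg)
    have hπr : ∀ x ∈ Set.Icc (-2 : ℝ) 2, ¬ (π ^ k).IsRoot x := fun x hx h => by
      rw [IsRoot.def, eval_pow, pow_eq_zero_iff hk] at h
      exact hroot ⟨x, hx, by rw [IsRoot.def, hg, eval_mul, h, zero_mul]⟩
    -- Without zeros in [-2, 2] the sign condition on ε is empty, so ε is free to make the order
    -- positive there.
    obtain ⟨ε, hε, hεpos⟩ := exists_pos_mul_eval hπr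
    obtain ⟨y, hy, hyy, hqy⟩ := exists_form_self_eq_recip hz (pow_ne_zero k hπ.ne_zero)
      huπ.pow_right hqz hzz hε (fun x hx h => absurd h (hπr x hx))
    exact ⟨y, hy, _, Or.inr ⟨⟨ε, π, k, hε, hπ, hk, rfl⟩, fun x hx => by
      rw [eval_mul, eval_C]; exact hεpos x hx⟩, hyy, hqy⟩

end Cyclic

/-! ### Orthogonal generators -/

section Generators

open Polynomial

variable {H : Type*} [AddCommGroup H] [Module Lam H] {lam : Form H}

/-- Orthogonal generators `z k` of `H` with `lam (z k) (z k) = 1 / d k`. -/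
structure DiagGen {κ : Type*} (lam : Form H) (z : κ → H) (d : κ → ℝ[X]) : Prop where
  ne_zero : ∀ k, d k ≠ 0
  self : ∀ k, lam (z k) (z k) = recip (d k)
  orth : ∀ k l, k ≠ l → lam (z k) (z l) = 0
  span : Submodule.span Lam (Set.range z) = ⊤

section

variable {κ ι : Type*} {z : κ → H} {d : κ → ℝ[X]}

theorem DiagGen.comp_equiv (h : DiagGen lam z d) (e : ι ≃ κ) :
    DiagGen lam (z ∘ e) (d ∘ e) where
  ne_zero k := h.ne_zero _
  self k := h.self _
  orth k l hkl := h.orth _ _ (e.injective.ne hkl)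
  span := by rw [e.surjective.range_comp, h.span]

theorem DiagGen.smul_eq_zero (h : DiagGen lam z d) (hl : IsNondeg lam) (k : κ) :
    ofPoly (d k) • z k = 0 := by
  refine hl.nondeg _ fun b => ?_
  have hle : (⊤ : Submodule Lam H) ≤ LinearMap.ker (lam (ofPoly (d k) • z k)) := by
    rw [← h.span, Submodule.span_le]
    rintro _ ⟨l, rfl⟩
    rw [SetLike.mem_coe, LinearMap.mem_ker, form_ofPoly_smul_left]
    by_cases hkl : k = l
    · rw [← hkl, h.self, ofPoly_smul_recip_self (h.ne_zero k)]
    · rw [h.orth k l hkl, smul_zero]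
  exact hle Submodule.mem_top

theorem isHerm_diagonal {n : ℕ} (d : Fin n → ℝ[X]) :
    IsHerm (diagonal fun i => ofPoly (d i)) := by
  rw [IsHerm, diagonal_map (map_zero _), diagonal_transpose]
  congr 1
  funext i
  exact conj_ofPoly _

theorem DiagGen.represents {n : ℕ} {z : Fin n → H} {d : Fin n → ℝ[X]} (h : DiagGen lam z d)
    (hl : IsNondeg lam) : Represents (diagonal fun i => ofPoly (d i)) lam := by
  have hd : (diagonal fun i => ofPoly (d i)).det ≠ 0 := by
    rw [det_diagonal, Finset.prod_ne_zero_iff]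
    exact fun i _ => ofPoly_ne_zero (h.ne_zero i)
  have hinv : ((diagonal fun i => ofPoly (d i)).map (algebraMap Lam Om))⁻¹ =
      diagonal fun i => (algebraMap Lam Om (ofPoly (d i)))⁻¹ := by
    refine inv_eq_left_inv ?_
    rw [diagonal_map (map_zero _), diagonal_mul_diagonal, ← diagonal_one]
    congr 1
    funext i
    exact inv_mul_cancel₀ (algebraMap_ofPoly_ne_zero (h.ne_zero i))
  refine hl.represents (isHerm_diagonal d) hd z h.span fun i j => ?_
  rw [hinv]
  by_cases hij : i = j
  · rw [← hij, diagonal_apply_eq, h.self, recip]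
  · rw [diagonal_apply_ne _ hij, h.orth i j hij, map_zero]

/-- The sign of a real number as an integer. -/
def sgn (x : ℝ) : ℤ := (SignType.sign x : ℤ)

/-- The indicator function of zero. -/
def zer (x : ℝ) : ℤ := if x = 0 then 1 else 0

theorem sgn_of_pos {x : ℝ} (h : 0 < x) : sgn x = 1 := by simp [sgn, h]

theorem sgn_of_neg {x : ℝ} (h : x < 0) : sgn x = -1 := by simp [sgn, h]

theorem sgn_zero : sgn 0 = 0 := by simp [sgn]

theorem sgn_mul (x y : ℝ) : sgn (x * y) = sgn x * sgn y := by simp [sgn, sign_mul]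

theorem zer_of_ne {x : ℝ} (h : x ≠ 0) : zer x = 0 := if_neg h

theorem zer_zero : zer 0 = 1 := if_pos rfl

theorem DiagGen.nul_eq_card [Fintype κ] (h : DiagGen lam z d) (hl : IsNondeg lam) {n : ℕ}
    {B : Matrix (Fin n) (Fin n) Lam} (hB : Represents B lam) (w : ℂˣ) :
    nul B w = Nat.card {k | aeval ((w : ℂ) + (w : ℂ)⁻¹) (d k) = 0} := by
  let e := (Fintype.equivFin κ).symm
  rw [nul_eq_of_represents hB ((h.comp_equiv e).represents hl)]
  have h1 : evalAt (diagonal fun i => ofPoly ((d ∘ e) i)) w =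
      diagonal fun i => aeval ((w : ℂ) + (w : ℂ)⁻¹) (d (e i)) := by
    rw [evalAt, diagonal_map (map_zero _)]
    congr 1
    funext i
    exact ev_ofPoly w _
  rw [nul, h1]
  refine (nulDim_diagonal _).trans ?_
  exact Nat.card_congr (e.subtypeEquiv fun i => Iff.rfl)

theorem DiagGen.nul_eq_sum [Fintype κ] (h : DiagGen lam z d) (hl : IsNondeg lam) {n : ℕ}
    {B : Matrix (Fin n) (Fin n) Lam} (hB : Represents B lam) (w : Circle) :
    (nul B (Circle.toUnits w) : ℤ) = ∑ k, zer ((d k).eval (2 * (w : ℂ).re)) := by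
  classical
  rw [h.nul_eq_card hl hB, circle_add_inv]
  have h1 : ∀ k, aeval ((2 * (w : ℂ).re : ℝ) : ℂ) (d k) = 0 ↔ (d k).eval (2 * (w : ℂ).re) = 0 :=
    fun k => by
      rw [show ((2 * (w : ℂ).re : ℝ) : ℂ) = algebraMap ℝ ℂ (2 * (w : ℂ).re) from rfl,
        aeval_algebraMap_apply_eq_algebraMap_eval]
      exact map_eq_zero _
  simp only [h1, zer, Finset.sum_boole]
  rw [Nat.card_eq_fintype_card, ← Fintype.card_subtype]
  rfl

theorem sgnt_diagonal {ι : Type*} [Fintype ι] [DecidableEq ι] (d : ι → ℝ) :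
    sgnt (diagonal fun i => (d i : ℂ)) = ∑ i, sgn (d i) := by
  have h : ∀ i, sgn (d i) = (if 0 < d i then 1 else 0) - if d i < 0 then 1 else 0 := fun i => by
    rcases lt_trichotomy (d i) 0 with h | h | h
    · simp [sgn_of_neg h, h, h.not_gt]
    · simp [h, sgn_zero]
    · simp [sgn_of_pos h, h, h.not_gt]
  rw [sgnt, posDim_diagonal, posDim_neg_diagonal, Finset.sum_congr rfl fun i _ => h i,
    Finset.sum_sub_distrib, Finset.sum_boole, Finset.sum_boole, Nat.card_eq_fintype_card,
    Nat.card_eq_fintype_card, ← Fintype.card_subtype, ← Fintype.card_subtype]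
  rfl

theorem DiagGen.sig_eq_sum [Fintype κ] (h : DiagGen lam z d) (hl : IsNondeg lam) {n : ℕ}
    {B : Matrix (Fin n) (Fin n) Lam} (hB : Represents B lam) (w : Circle) :
    sig B w = ∑ k, (sgn ((d k).eval (2 * (w : ℂ).re)) - sgn ((d k).eval 2)) := by
  let e := (Fintype.equivFin κ).symm
  rw [sig_eq_of_represents hB ((h.comp_equiv e).represents hl)]
  have h1 : ∀ w : Circle, evalAt (diagonal fun i => ofPoly ((d ∘ e) i)) (Circle.toUnits w) =
      diagonal fun i => (((d (e i)).eval (2 * (w : ℂ).re) : ℝ) : ℂ) := fun w => by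
    rw [evalAt, diagonal_map (map_zero _)]
    congr 1
    funext i
    exact ev_circle_ofPoly w _
  have h2 := h1 1
  rw [map_one] at h2
  rw [sig, h1, h2, sign_eq_sgnt, sign_eq_sgnt, sgnt_diagonal, sgnt_diagonal,
    e.sum_comp (fun k => sgn ((d k).eval (2 * (w : ℂ).re))),
    e.sum_comp (fun k => sgn ((d k).eval (2 * ((1 : Circle) : ℂ).re))), ← Finset.sum_sub_distrib]
  simp

/-- Two of the generators, of coprime orders with compatible signs, are combined to one. -/
theorem DiagGen.absorb [DecidableEq κ] (h : DiagGen lam z d) (hl : IsNondeg lam) {k l : κ}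
    (hkl : k ≠ l) (hcop : IsCoprime (d k) (d l)) {ε : ℝ} (hε : ε ≠ 0)
    (h1 : ∀ x ∈ Set.Icc (-2 : ℝ) 2, (d k).IsRoot x → 0 < ε * (d l).eval x)
    (h2 : ∀ x ∈ Set.Icc (-2 : ℝ) 2, (d l).IsRoot x → 0 < ε * (d k).eval x) :
    ∃ z' : κ → H, DiagGen lam z'
      (Function.update (Function.update d k (C ε * (d k * d l))) l 1) := by
  obtain ⟨x, hx, hspan⟩ := hl.exists_absorb (h.ne_zero k) (h.ne_zero l) hcop hε h1 h2 (h.self k)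
    (h.self l) (h.orth k l hkl) (h.smul_eq_zero hl k) (h.smul_eq_zero hl l)
  obtain ⟨a, b, rfl⟩ := Submodule.mem_span_pair.1
    ((Submodule.span_singleton_le_iff_mem _ _).1 hspan.le)
  have horth : ∀ m, m ≠ k → m ≠ l → lam (z m) (a • z k + b • z l) = 0 := fun m hmk hml => by
    rw [map_add, map_smul, map_smul, h.orth m k hmk, h.orth m l hml, smul_zero, smul_zero,
      add_zero]
  -- The slot `l` keeps a zero generator of order 1, so that the index type stays the same.
  refine ⟨Function.update (Function.update z k (a • z k + b • z l)) l 0, ?_, ?_, ?_, ?_⟩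
  · intro m
    rcases eq_or_ne m l with rfl | hml
    · simp
    rcases eq_or_ne m k with rfl | hmk
    · rw [Function.update_of_ne hml, Function.update_self]
      exact mul_ne_zero (C_ne_zero.2 hε) (mul_ne_zero (h.ne_zero _) (h.ne_zero _))
    · rw [Function.update_of_ne hml, Function.update_of_ne hmk]
      exact h.ne_zero m
  · intro m
    rcases eq_or_ne m l with rfl | hml
    · rw [Function.update_self, Function.update_self, map_zero, eq_comm,
        ← one_smul Lam (recip 1), smul_recip_eq_zero one_ne_zero, map_one]
    rcases eq_or_ne m k with rfl | hmk
    · rw [Function.update_of_ne hml, Function.update_self, Function.update_of_ne hml,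
        Function.update_self, hx]
    · rw [Function.update_of_ne hml, Function.update_of_ne hmk, Function.update_of_ne hml,
        Function.update_of_ne hmk]
      exact h.self m
  · intro m m' hmm
    rcases eq_or_ne m l with rfl | hml
    · rw [Function.update_self, map_zero, LinearMap.zero_apply]
    rcases eq_or_ne m' l with rfl | hml'
    · rw [Function.update_self, map_zero]
    rw [Function.update_of_ne hml, Function.update_of_ne hml']
    rcases eq_or_ne m k with rfl | hmk
    · rw [Function.update_self, Function.update_of_ne hmm.symm]
      exact hl.eq_zero_of_right (horth m' hmm.symm hml')
    rcases eq_or_ne m' k with rfl | hmk'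
    · rw [Function.update_self, Function.update_of_ne hmk]
      exact horth m hmk hml
    · rw [Function.update_of_ne hmk, Function.update_of_ne hmk']
      exact h.orth m m' hmm
  · rw [eq_top_iff, ← h.span, Submodule.span_le]
    set z' := Function.update (Function.update z k (a • z k + b • z l)) l 0 with hz'
    have hk : z' k = a • z k + b • z l := by
      rw [hz', Function.update_of_ne hkl, Function.update_self]
    have hsub : Submodule.span Lam {z k, z l} ≤ Submodule.span Lam (Set.range z') := by
      rw [← hspan, Submodule.span_singleton_le_iff_mem, ← hk]
      exact Submodule.subset_span ⟨k, rfl⟩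
    rintro _ ⟨m, rfl⟩
    rcases eq_or_ne m l with rfl | hml
    · exact hsub (Submodule.subset_span (by simp))
    rcases eq_or_ne m k with rfl | hmk
    · exact hsub (Submodule.subset_span (by simp))
    · refine Submodule.subset_span ⟨m, ?_⟩
      rw [hz', Function.update_of_ne hml, Function.update_of_ne hmk]

end

instance isNoetherianRing_lam : IsNoetherianRing Lam :=
  IsLocalization.isNoetherianRing (Submonoid.powers (X : ℝ[X])) Lam inferInstance

/-- A form with trivial radical on a torsion module without `(t² - 1)`-torsion is an orthogonal sum
of primary cyclic forms. -/
theorem exists_diagGen_primary (hl : IsNondeg lam) [Module.Finite Lam H]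
    (htau : ∀ h : H, tau • h = 0 → h = 0) {r : Lam} (hr0 : r ≠ 0) (hr : ∀ h : H, r • h = 0) :
    ∃ (m : ℕ) (z : Fin m → H) (d : Fin m → ℝ[X]), DiagGen lam z d ∧ ∀ k, IsPrimary (d k) := by
  let S : Set (Submodule Lam H) := {M | ∃ (m : ℕ) (z : Fin m → H) (d : Fin m → ℝ[X]),
    (∀ k, IsPrimary (d k)) ∧ (∀ k, lam (z k) (z k) = recip (d k)) ∧
    (∀ k l, k ≠ l → lam (z k) (z l) = 0) ∧ (∀ k, ofPoly (d k) • z k = 0) ∧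
    Submodule.span Lam (Set.range z) = M}
  have hS : S.Nonempty := ⟨⊥, 0, Fin.elim0, Fin.elim0, fun k => k.elim0, fun k => k.elim0,
    fun k => k.elim0, fun k => k.elim0, by simp⟩
  -- Take a maximal submodule spanned by orthogonal primary generators. If it is proper, its
  -- orthogonal complement K is a non-zero summand with trivial radical and contains another primary
  -- generator.
  obtain ⟨M, ⟨m, z, d, hd, hself, horth, hkill, hspan⟩, hmax⟩ :=
    set_has_maximal_iff_noetherian.mpr
      (isNoetherian_of_isNoetherianRing_of_finite Lam H) S hS
  by_cases hM : M = ⊤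
  · exact ⟨m, z, d, ⟨fun k => (hd k).ne_zero, hself, horth, hspan.trans hM⟩, hd⟩
  exfalso
  let K : Submodule Lam H := ⨅ k, LinearMap.ker (lam (z k))
  have hKmem : ∀ {y}, y ∈ K ↔ ∀ k, lam (z k) y = 0 := fun {y} => by
    simp [K, Submodule.mem_iInf]
  have hzM : ∀ k, z k ∈ M := fun k => hspan ▸ Submodule.subset_span ⟨k, rfl⟩
  -- Each value λ(z_k, h) is a multiple of 1/d_k = λ(z_k, z_k), so orthogonal projection to M is
  -- possible over Λ.
  have hMK : M ⊔ K = ⊤ := by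
    rw [eq_top_iff]
    intro h _
    have h1 : ∀ k, ∃ p : Lam, lam (z k) h = p • recip (d k) := fun k =>
      exists_smul_recip_eq (hd k).ne_zero (by
        rw [← form_ofPoly_smul_left, hkill, map_zero, LinearMap.zero_apply])
    choose p hp using h1
    refine Submodule.mem_sup.2 ⟨∑ k, p k • z k, M.sum_mem fun k _ => M.smul_mem _ (hzM k),
      h - ∑ k, p k • z k, hKmem.2 fun k => ?_, by abel⟩
    rw [map_sub, map_sum, Finset.sum_eq_single k, map_smul, hself, hp, sub_self]
    · intro l _ hlk
      rw [map_smul, horth k l hlk.symm, smul_zero]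
    · simp
  have hK0 : K ≠ ⊥ := fun h => hM (by rwa [h, sup_bot_eq] at hMK)
  have hKnd : ∀ y ∈ K, (∀ w ∈ K, lam w y = 0) → y = 0 := by
    intro y hy hyK
    refine hl.nondeg y fun b => ?_
    have hle : (⊤ : Submodule Lam H) ≤ LinearMap.ker (lam y) := by
      rw [← hMK, ← hspan]
      refine sup_le (Submodule.span_le.2 ?_) fun w hw => hl.eq_zero_of_right (hyK w hw)
      rintro _ ⟨k, rfl⟩
      exact hl.eq_zero_of_right (hKmem.1 hy k)
    exact hle Submodule.mem_top
  obtain ⟨y, hy, e, he, hye, hkilly⟩ := exists_primary hl htau hr0 hr hK0 hKnd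
  refine hmax (Submodule.span Lam (Set.range (Fin.cons y z : Fin (m + 1) → H))) ⟨m + 1,
    Fin.cons y z, Fin.cons e d, ?_, ?_, ?_, ?_, rfl⟩ ?_
  · exact Fin.cases he hd
  · exact Fin.cases hye hself
  · refine Fin.cases (Fin.cases (fun h => absurd rfl h) fun l _ => ?_) fun k =>
      Fin.cases (fun _ => ?_) fun l hkl => ?_
    · exact hl.eq_zero_of_right (hKmem.1 hy l)
    · exact hKmem.1 hy k
    · exact horth k l fun h => hkl (by rw [h])
  · exact Fin.cases hkilly hkill
  · rw [Fin.range_cons]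
    refine lt_of_le_of_ne ?_ fun h => ?_
    · rw [← hspan]
      exact Submodule.span_mono (Set.subset_insert _ _)
    · have hyM : y ∈ M := by
        rw [h]
        exact Submodule.subset_span (Set.mem_insert _ _)
      have hle : M ≤ LinearMap.ker (lam y) := by
        rw [← hspan, Submodule.span_le]
        rintro _ ⟨k, rfl⟩
        exact hl.eq_zero_of_right (hKmem.1 hy k)
      exact recip_ne_zero he.ne_zero he.not_isUnit (hye.symm.trans (hle hyM))

end Generators

/-! ### Minimal diagonal representatives -/

section Minimal

open Polynomial

variable {H : Type*} [AddCommGroup H] [Module Lam H] {lam : Form H}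

theorem zer_nonneg (x : ℝ) : 0 ≤ zer x := by unfold zer; split_ifs <;> norm_num

/-- Orthogonal generators, the last `m` of which are trivial or primary and have their zeros in
`[-2, 2]` to the left of the zeros of the first `N`. -/
structure Sweep (lam : Form H) {N m : ℕ} (q : ℕ) (z : Fin N ⊕ Fin m → H)
    (d : Fin N ⊕ Fin m → ℝ[X]) : Prop where
  diag : DiagGen lam z d
  primary : ∀ j, d (Sum.inr j) = 1 ∨ IsPrimary (d (Sum.inr j))
  roots : ∀ i j, ∀ x ∈ Set.Icc (-2 : ℝ) 2, ∀ y ∈ Set.Icc (-2 : ℝ) 2, (d (Sum.inl i)).IsRoot x →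
    (d (Sum.inr j)).IsRoot y → y ≤ x
  -- The signature of the leading block at t = 1, kept fixed by every merger.
  sum : ∑ i, sgn ((d (Sum.inl i)).eval 2) = N - 2 * q

variable {N m q : ℕ} {z : Fin N ⊕ Fin m → H} {d : Fin N ⊕ Fin m → ℝ[X]}

open Classical in
/-- The number of non-trivial generators among the last ones. -/
def active (d : Fin N ⊕ Fin m → ℝ[X]) : ℕ :=
  (Finset.univ.filter fun j => d (Sum.inr j) ≠ 1).card

/-- Merges the trailing generator j into the leading slot i. `h3` makes the new order agree in sign
with the old one at 2, which preserves the signature there. `h4` says that the zeros of j are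
right-most among the trailing ones, which preserves the order of zeros. -/
theorem Sweep.advance (h : Sweep lam q z d) (hl : IsNondeg lam) {i : Fin N} {j : Fin m}
    (hj : d (Sum.inr j) ≠ 1) (hcop : IsCoprime (d (Sum.inl i)) (d (Sum.inr j))) {ε : ℝ}
    (hε : ε ≠ 0)
    (h1 : ∀ x ∈ Set.Icc (-2 : ℝ) 2, (d (Sum.inl i)).IsRoot x → 0 < ε * (d (Sum.inr j)).eval x)
    (h2 : ∀ x ∈ Set.Icc (-2 : ℝ) 2, (d (Sum.inr j)).IsRoot x → 0 < ε * (d (Sum.inl i)).eval x)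
    (h3 : 0 < ε * (d (Sum.inr j)).eval 2)
    (h4 : ∀ j', ∀ x ∈ Set.Icc (-2 : ℝ) 2, ∀ y ∈ Set.Icc (-2 : ℝ) 2, (d (Sum.inr j)).IsRoot x →
      (d (Sum.inr j')).IsRoot y → y ≤ x) :
    ∃ (z' : Fin N ⊕ Fin m → H) (d' : Fin N ⊕ Fin m → ℝ[X]), Sweep lam q z' d' ∧
      active d' < active d := by
  classical
  obtain ⟨z', hz'⟩ := h.diag.absorb hl Sum.inl_ne_inr hcop hε h1 h2
  set d' := Function.update (Function.update d (Sum.inl i) (C ε * (d (Sum.inl i) * d (Sum.inr j))))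
    (Sum.inr j) 1 with hd'
  have e1 : d' (Sum.inl i) = C ε * (d (Sum.inl i) * d (Sum.inr j)) := by simp [hd']
  have e2 : ∀ i', i' ≠ i → d' (Sum.inl i') = d (Sum.inl i') := fun i' hi => by
    simp [hd', hi]
  have e3 : d' (Sum.inr j) = 1 := by simp [hd']
  have e4 : ∀ j', j' ≠ j → d' (Sum.inr j') = d (Sum.inr j') := fun j' hj => by
    simp [hd', hj]
  refine ⟨z', d', ⟨hz', fun j' => ?_, fun i' j' x hx y hy hix hjy => ?_, ?_⟩, ?_⟩
  · by_cases hjj : j' = j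
    · rw [hjj]; exact Or.inl e3
    · rw [e4 j' hjj]; exact h.primary j'
  · by_cases hjj : j' = j
    · rw [hjj, e3, IsRoot.def, eval_one] at hjy
      exact absurd hjy one_ne_zero
    rw [e4 j' hjj] at hjy
    by_cases hii : i' = i
    · rw [hii, e1, IsRoot.def, eval_mul, eval_mul, eval_C] at hix
      rcases mul_eq_zero.1 hix with h0 | h0
      · exact absurd h0 hε
      rcases mul_eq_zero.1 h0 with h0 | h0
      · exact h.roots i j' x hx y hy h0 hjy
      · exact h4 j' x hx y hy h0 hjy
    · rw [e2 i' hii] at hix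
      exact h.roots i' j' x hx y hy hix hjy
  · rw [← h.sum]
    refine Finset.sum_congr rfl fun i' _ => ?_
    by_cases hii : i' = i
    · rw [hii, e1, eval_mul, eval_mul, eval_C, mul_left_comm, sgn_mul, sgn_of_pos h3, mul_one]
    · rw [e2 i' hii]
  · refine Finset.card_lt_card ⟨fun j' hj' => ?_, fun hsub => ?_⟩
    · rw [Finset.mem_filter] at hj' ⊢
      refine ⟨Finset.mem_univ _, ?_⟩
      by_cases hjj : j' = j
      · rw [hjj]; exact hj
      · rw [← e4 j' hjj]; exact hj'.2
    · have := hsub (Finset.mem_filter.2 ⟨Finset.mem_univ j, hj⟩)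
      exact (Finset.mem_filter.1 this).2 e3

variable {n : ℕ} {B : Matrix (Fin n) (Fin n) Lam}

/-- The bound on the nullity leaves room for a generator whose order is prime to `π`. -/
theorem Sweep.exists_coprime (h : Sweep lam q z d) (hl : IsNondeg lam) (hB : Represents B lam)
    (heta : ∀ w, nul B w ≤ N) {π : ℝ[X]} (hπ : Irreducible π) {j : Fin m}
    (hj : π ∣ d (Sum.inr j)) : ∃ i, ¬ π ∣ d (Sum.inl i) := by
  by_contra! hcon
  -- Otherwise all N leading orders and the j-th trailing one vanish over a zero of π, so the
  -- nullity there is at least N + 1.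
  obtain ⟨w, hw⟩ := IsAlgClosed.exists_aeval_eq_zero ℂ π (degree_pos_of_irreducible hπ).ne'
  obtain ⟨u, hu⟩ := exists_add_inv_eq w
  have h1 := heta u
  rw [h.diag.nul_eq_card hl hB, hu] at h1
  let φ : Option (Fin N) → {k | aeval w (d k) = 0} := fun o => match o with
    | none => ⟨Sum.inr j, by
        obtain ⟨s, hs⟩ := hj
        simp [hs, hw]⟩
    | some i => ⟨Sum.inl i, by
        obtain ⟨s, hs⟩ := hcon i
        simp [hs, hw]⟩
  have hφ : Function.Injective φ := by
    rintro (_ | i) (_ | i') hii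
    · rfl
    · simp [φ] at hii
    · simp [φ] at hii
    · simpa [φ] using hii
  have h2 := Nat.card_le_card_of_injective φ hφ
  rw [Nat.card_eq_fintype_card, Fintype.card_option, Fintype.card_fin] at h2
  omega

/-- The inequalities between the nullity and the signature leave room for a generator whose order
has the right-most zero. -/
theorem Sweep.exists_sign (h : Sweep lam q z d) (hl : IsNondeg lam) (hB : Represents B lam)
    (hpos : ∀ w : Circle, (nul B (Circle.toUnits w) : ℤ) + sig B w ≤ 2 * q)
    (hneg : ∀ w : Circle, (nul B (Circle.toUnits w) : ℤ) - sig B w ≤ 2 * (N - q))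
    {c ε : ℝ} (hc : c ∈ Set.Ioo (-2 : ℝ) 2) (hε : ε ≠ 0) {j : Fin m} {k : ℕ} (hk : k ≠ 0)
    (hj : d (Sum.inr j) = C ε * (X - C c) ^ k)
    (hlin : ∀ j', d (Sum.inr j') = 1 ∨ ∃ (ε' c' : ℝ) (k' : ℕ), ε' ≠ 0 ∧ c' ≤ c ∧ k' ≠ 0 ∧
      d (Sum.inr j') = C ε' * (X - C c') ^ k') :
    ∃ i, 0 < ε * (d (Sum.inl i)).eval c := by
  by_contra! hcon
  obtain ⟨w, hw⟩ := exists_circle_re (Set.Ioo_subset_Icc_self hc)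
  set s := sgn ε with hs
  have hs1 : s * s = 1 := by
    rw [hs, ← sgn_mul]
    exact sgn_of_pos (mul_self_pos.2 hε)
  have hs2 : s = 1 ∨ s = -1 := by
    rcases lt_or_gt_of_ne hε with h0 | h0
    · exact Or.inr (sgn_of_neg h0)
    · exact Or.inl (sgn_of_pos h0)
  have hnul := h.diag.nul_eq_sum hl hB w
  have hsig := h.diag.sig_eq_sum hl hB w
  rw [hw, Fintype.sum_sum_type] at hnul hsig
  -- Let s = sgn ε. Without a suitable slot each leading order adds exactly 1 to η - s(sign at c),
  -- trailing orders add at least 0 to η - sσ, and the j-th adds 2. In all η - sσ ≥ N + s(N - 2q) +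
  -- 2, which contradicts `hneg` for s = 1 and `hpos` for s = -1.
  have e1 : ∀ i, zer ((d (Sum.inl i)).eval c) - s * sgn ((d (Sum.inl i)).eval c) = 1 := by
    intro i
    by_cases h0 : (d (Sum.inl i)).eval c = 0
    · rw [h0, zer_zero, sgn_zero]; ring
    · rw [zer_of_ne h0, hs, ← sgn_mul,
        sgn_of_neg (lt_of_le_of_ne (hcon i) (mul_ne_zero hε h0))]
      ring
  have e2 : ∀ j', 0 ≤ zer ((d (Sum.inr j')).eval c) - s * (sgn ((d (Sum.inr j')).eval c) -
      sgn ((d (Sum.inr j')).eval 2)) := by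
    intro j'
    rcases hlin j' with h1 | ⟨ε', c', k', hε', hc', hk', h1⟩
    · rw [h1, eval_one, eval_one, sub_self, mul_zero, sub_zero]
      exact zer_nonneg _
    · have h2 : 0 < (2 - c') ^ k' := pow_pos (by linarith [hc.2]) _
      have h3 : sgn ε' = 1 ∨ sgn ε' = -1 := by
        rcases lt_or_gt_of_ne hε' with h0 | h0
        · exact Or.inr (sgn_of_neg h0)
        · exact Or.inl (sgn_of_pos h0)
      simp only [h1, eval_mul, eval_C, eval_pow, eval_sub, eval_X, sgn_mul, sgn_of_pos h2, mul_one]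
      rcases hc'.lt_or_eq with h4 | h4
      -- An order whose zero is left of c has the same sign at c and at 2.
      · rw [sgn_of_pos (pow_pos (sub_pos.2 h4) _), mul_one, sub_self, mul_zero, sub_zero]
        exact zer_nonneg _
      · rw [h4, sub_self, zero_pow hk', mul_zero, zer_zero, sgn_zero]
        rcases hs2 with h5 | h5 <;> rcases h3 with h6 | h6 <;> rw [h5, h6] <;> norm_num
  have e3 : 2 ≤ zer ((d (Sum.inr j)).eval c) - s * (sgn ((d (Sum.inr j)).eval c) -
      sgn ((d (Sum.inr j)).eval 2)) := by
    have h2 : 0 < (2 - c) ^ k := pow_pos (by linarith [hc.2]) _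
    simp only [hj, eval_mul, eval_C, eval_pow, eval_sub, eval_X, sgn_mul, sgn_of_pos h2, mul_one]
    rw [sub_self, zero_pow hk, mul_zero, zer_zero, sgn_zero, ← hs]
    linarith
  have e4 := Finset.single_le_sum (fun j' _ => e2 j') (Finset.mem_univ j)
  have e5 : ∑ i, (zer ((d (Sum.inl i)).eval c) - s * sgn ((d (Sum.inl i)).eval c)) = N := by
    simp [e1]
  have e6 := h.sum
  simp only [Finset.sum_sub_distrib, ← Finset.mul_sum] at e4 e5 hsig
  have h1 := hpos w
  have h2 := hneg w
  rcases hs2 with h5 | h5 <;> rw [h5] at e3 e4 e5 <;> linarith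

/-- Trailing orders positive on [-2, 2] go first, with ε = 1; they only need a coprime slot,
provided by the bound on η. After that only powers of linear factors remain, and one with right-most
zero is merged, ε being its leading coefficient. The zeros of the leading orders then lie to its
right, where its sign is known. -/
theorem Sweep.exists_advance (h : Sweep lam q z d) (hl : IsNondeg lam) (hB : Represents B lam)
    (heta : ∀ w, nul B w ≤ N)
    (hpos : ∀ w : Circle, (nul B (Circle.toUnits w) : ℤ) + sig B w ≤ 2 * q)
    (hneg : ∀ w : Circle, (nul B (Circle.toUnits w) : ℤ) - sig B w ≤ 2 * (N - q))
    (hact : ∃ j, d (Sum.inr j) ≠ 1) :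
    ∃ (z' : Fin N ⊕ Fin m → H) (d' : Fin N ⊕ Fin m → ℝ[X]), Sweep lam q z' d' ∧
      active d' < active d := by
  classical
  by_cases hhyp : ∃ j, (∃ (ε : ℝ) (π : ℝ[X]) (k : ℕ), ε ≠ 0 ∧ Irreducible π ∧ k ≠ 0 ∧
      d (Sum.inr j) = C ε * π ^ k) ∧ ∀ x ∈ Set.Icc (-2 : ℝ) 2, 0 < (d (Sum.inr j)).eval x
  · obtain ⟨j, ⟨ε, π, k, hε, hπ, hk, hj⟩, hjpos⟩ := hhyp
    obtain ⟨i, hi⟩ := h.exists_coprime hl hB heta hπ (j := j)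
      (by rw [hj]; exact (dvd_pow_self π hk).mul_left _)
    refine h.advance hl (i := i) (j := j) ?_ ?_ one_ne_zero (fun x hx _ => ?_)
      (fun x hx hr => ?_) ?_ (fun j' x hx y hy hr => ?_)
    · intro h1
      have := IsPrimary.not_isUnit (Or.inr ⟨⟨ε, π, k, hε, hπ, hk, hj⟩, hjpos⟩)
      rw [h1] at this
      exact this isUnit_one
    · rw [hj]
      exact ((isCoprime_mul_unit_left_right (isUnit_C.2 hε.isUnit) _ _).2
        (((hπ.coprime_iff_not_dvd).2 hi).symm.pow_right))
    · rw [one_mul]; exact hjpos x hx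
    · exact absurd hr.eq_zero (hjpos x hx).ne'
    · rw [one_mul]; exact hjpos 2 (by norm_num)
    · exact absurd hr.eq_zero (hjpos x hx).ne'
  · have hlin : ∀ j, d (Sum.inr j) ≠ 1 → ∃ (ε c : ℝ) (k : ℕ), ε ≠ 0 ∧ c ∈ Set.Ioo (-2 : ℝ) 2 ∧
        k ≠ 0 ∧ d (Sum.inr j) = C ε * (X - C c) ^ k := by
      intro j hj
      rcases h.primary j with h1 | h1 | h1
      · exact absurd h1 hj
      · exact h1
      · exact absurd ⟨j, h1⟩ hhyp
    choose! e c k he hc hk hd using hlin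
    obtain ⟨j₀, hj₀⟩ := hact
    obtain ⟨j, hj, hjmax⟩ := Finset.exists_max_image
      (Finset.univ.filter fun j => d (Sum.inr j) ≠ 1) c
      ⟨j₀, Finset.mem_filter.2 ⟨Finset.mem_univ _, hj₀⟩⟩
    have hj := (Finset.mem_filter.1 hj).2
    have hmax : ∀ j', d (Sum.inr j') ≠ 1 → c j' ≤ c j := fun j' hj' =>
      hjmax j' (Finset.mem_filter.2 ⟨Finset.mem_univ _, hj'⟩)
    have hroot : ∀ j', d (Sum.inr j') ≠ 1 → ∀ x, (d (Sum.inr j')).IsRoot x ↔ x = c j' := by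
      intro j' hj' x
      rw [hd j' hj', IsRoot.def, eval_mul, eval_C, eval_pow, eval_sub, eval_X, eval_C,
        mul_eq_zero_iff_left (he j' hj'), pow_eq_zero_iff (hk j' hj'), sub_eq_zero]
    obtain ⟨i, hi⟩ := h.exists_sign hl hB hpos hneg (hc j hj) (he j hj) (hk j hj) (hd j hj)
      (fun j' => by
        by_cases hj' : d (Sum.inr j') = 1
        · exact Or.inl hj'
        · exact Or.inr ⟨e j', c j', k j', he j' hj', hmax j' hj', hk j' hj', hd j' hj'⟩)
    have hval : ∀ x, c j < x → 0 < e j * (d (Sum.inr j)).eval x := by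
      intro x hx
      rw [hd j hj, eval_mul, eval_C, eval_pow, eval_sub, eval_X, eval_C, ← mul_assoc]
      exact mul_pos (mul_self_pos.2 (he j hj)) (pow_pos (sub_pos.2 hx) _)
    refine h.advance hl (i := i) (j := j) hj ?_ (he j hj) (fun x hx hr => ?_)
      (fun x hx hr => ?_) (hval 2 (hc j hj).2) (fun j' x hx y hy hr hr' => ?_)
    · rw [hd j hj]
      refine (isCoprime_mul_unit_left_right (isUnit_C.2 (he j hj).isUnit) _ _).2
        (IsCoprime.pow_right (((irreducible_X_sub_C _).coprime_iff_not_dvd).2 fun hdvd => ?_).symm)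
      rw [(dvd_iff_isRoot.1 hdvd).eq_zero, mul_zero] at hi
      exact lt_irrefl _ hi
    · refine hval x (lt_of_le_of_ne ?_ ?_)
      · exact h.roots i j x hx (c j) (Set.Ioo_subset_Icc_self (hc j hj)) hr ((hroot j hj _).2 rfl)
      · rintro rfl
        rw [hr.eq_zero, mul_zero] at hi
        exact lt_irrefl _ hi
    · rw [(hroot j hj x).1 hr]; exact hi
    · by_cases hj' : d (Sum.inr j') = 1
      · rw [hj', IsRoot.def, eval_one] at hr'
        exact absurd hr' one_ne_zero
      · rw [(hroot j hj x).1 hr, (hroot j' hj' y).1 hr']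
        exact hmax j' hj'

theorem Sweep.exists_diagGen (h : Sweep lam q z d) (hl : IsNondeg lam) (hB : Represents B lam)
    (heta : ∀ w, nul B w ≤ N)
    (hpos : ∀ w : Circle, (nul B (Circle.toUnits w) : ℤ) + sig B w ≤ 2 * q)
    (hneg : ∀ w : Circle, (nul B (Circle.toUnits w) : ℤ) - sig B w ≤ 2 * (N - q)) :
    ∃ (z : Fin N → H) (d : Fin N → ℝ[X]), DiagGen lam z d := by
  induction hn : active d using Nat.strong_induction_on generalizing z d with
  | _ a ih =>
  subst hn
  by_cases hact : ∃ j, d (Sum.inr j) ≠ 1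
  · obtain ⟨z', d', h', hlt⟩ := h.exists_advance hl hB heta hpos hneg hact
    exact ih _ hlt h' rfl
  · push Not at hact
    refine ⟨z ∘ Sum.inl, d ∘ Sum.inl, fun i => h.diag.ne_zero _, fun i => h.diag.self _,
      fun i i' hii => h.diag.orth _ _ (Sum.inl_injective.ne hii), ?_⟩
    rw [eq_top_iff, ← h.diag.span, Submodule.span_le]
    rintro _ ⟨i | j, rfl⟩
    · exact Submodule.subset_span ⟨i, rfl⟩
    · have := h.diag.smul_eq_zero hl (Sum.inr j)
      rw [hact, map_one, one_smul] at this
      rw [this]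
      exact Submodule.zero_mem _

/-- A constant order ±1 has reciprocal in Λ, so the zero vector is a generator of that order; q
minus signs give the prescribed signature. -/
theorem Sweep.initial {y : Fin m → H} {e : Fin m → ℝ[X]} (h : DiagGen lam y e)
    (he : ∀ j, IsPrimary (e j)) (hq : q ≤ N) :
    Sweep lam q (Sum.elim (fun _ : Fin N => 0) y)
      (Sum.elim (fun i : Fin N => C (if (i : ℕ) < q then -1 else 1)) e) := by
  have hne : ∀ i : Fin N, (if (i : ℕ) < q then (-1 : ℝ) else 1) ≠ 0 := fun i => by
    split_ifs <;> norm_num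
  refine ⟨⟨?_, ?_, ?_, ?_⟩, fun j => Or.inr (he j), ?_, ?_⟩
  · rintro (i | j)
    · exact C_ne_zero.2 (hne i)
    · exact h.ne_zero j
  · rintro (i | j)
    · have : recip (C (if (i : ℕ) < q then (-1 : ℝ) else 1)) = 0 := by
        rw [← one_smul Lam (recip _), smul_recip_eq_zero (C_ne_zero.2 (hne i))]
        exact ((isUnit_C.2 (hne i).isUnit).map ofPoly).dvd
      simp [this]
    · exact h.self j
  · rintro (i | j) (i' | j') hne
    · simp
    · simp
    · simp
    · exact h.orth j j' fun hj => hne (by rw [hj])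
  · rw [eq_top_iff, ← h.span]
    refine Submodule.span_mono ?_
    rintro _ ⟨j, rfl⟩
    exact ⟨Sum.inr j, rfl⟩
  · intro i j x _ y _ hx
    simp only [Sum.elim_inl, IsRoot.def, eval_C] at hx
    exact absurd hx (hne i)
  · have h1 : ∀ i : Fin N, sgn (eval 2 (C (if (i : ℕ) < q then (-1 : ℝ) else 1))) =
        1 - 2 * if (i : ℕ) < q then 1 else 0 := fun i => by
      rw [eval_C]
      split_ifs
      · rw [sgn_of_neg (by norm_num)]; norm_num
      · rw [sgn_of_pos one_pos]; norm_num
    simp only [Sum.elim_inl]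
    rw [Finset.sum_congr rfl fun i _ => h1 i, Finset.sum_sub_distrib, ← Finset.mul_sum,
      Fin.sum_univ_eq_sum_range (fun i => if i < q then (1 : ℤ) else 0) N, Finset.sum_boole]
    have h2 : (Finset.range N).filter (· < q) = Finset.range q := by
      ext i
      simp only [Finset.mem_filter, Finset.mem_range]
      omega
    rw [h2]
    simp

end Minimal

/-! ### Bounds on the size and proof of the theorem -/

section Main

variable {H : Type*} [AddCommGroup H] [Module Lam H] {lam : Form H}

theorem nul_add_sign_le {n : ℕ} {A : Matrix (Fin n) (Fin n) Lam} (hA : IsHerm A) (w : Circle) :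
    (nul A (Circle.toUnits w) : ℤ) + sign (evalAt A (Circle.toUnits w)) ≤ n ∧
    (nul A (Circle.toUnits w) : ℤ) - sign (evalAt A (Circle.toUnits w)) ≤ n := by
  have h := posDim_add_posDim_neg_add_nulDim (isHermitian_evalAt hA w)
  rw [Fintype.card_fin] at h
  have hn : nul A (Circle.toUnits w) = nulDim (evalAt A (Circle.toUnits w)) := rfl
  rw [hn, sign_eq_sgnt, sgnt]
  constructor <;> omega

theorem nul_le_card {n : ℕ} (A : Matrix (Fin n) (Fin n) Lam) (w : ℂˣ) : nul A w ≤ n := by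
  have h := Submodule.finrank_le (LinearMap.ker (evalAt A w).mulVecLin)
  rwa [Module.finrank_fintype_fun_eq_card, Fintype.card_fin] at h

theorem bddAbove_nul {n : ℕ} (A : Matrix (Fin n) (Fin n) Lam) :
    BddAbove (Set.range fun w : ℂˣ => nul A w) :=
  ⟨n, by rintro _ ⟨w, rfl⟩; exact nul_le_card A w⟩

theorem nul_add_sig_le {n : ℕ} {A : Matrix (Fin n) (Fin n) Lam} (hA : IsHerm A) (w : Circle) :
    (nul A (Circle.toUnits w) : ℤ) + sig A w ≤ n - sign (evalAt A 1) := by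
  have := (nul_add_sign_le hA w).1
  unfold sig
  omega

theorem nul_sub_sig_le {n : ℕ} {A : Matrix (Fin n) (Fin n) Lam} (hA : IsHerm A) (w : Circle) :
    (nul A (Circle.toUnits w) : ℤ) - sig A w ≤ n + sign (evalAt A 1) := by
  have := (nul_add_sign_le hA w).2
  unfold sig
  omega

/-- The size of a hermitian matrix is at least `μ(A)` and `η(A)`. -/
theorem max_muMat_etaMat_le {n : ℕ} {A : Matrix (Fin n) (Fin n) Lam} (hA : IsHerm A) :
    max (muMat A) (etaMat A : ℚ) ≤ n := by
  refine max_le ?_ ?_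
  · have h1 : (⨆ w : Circle, ((nul A (Circle.toUnits w) : ℤ) + sig A w)) ≤ _ :=
      ciSup_le fun w => nul_add_sig_le hA w
    have h2 : (⨆ w : Circle, ((nul A (Circle.toUnits w) : ℤ) - sig A w)) ≤ _ :=
      ciSup_le fun w => nul_sub_sig_le hA w
    rw [muMat, div_le_iff₀ two_pos]
    exact_mod_cast (by linarith : _ + _ ≤ (n : ℤ) * 2)
  · exact_mod_cast (ciSup_le fun w => nul_le_card A w : etaMat A ≤ n)

theorem IsNondeg.exists_represents (hl : IsNondeg lam) [Module.Finite Lam H]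
    (htau : ∀ h : H, tau • h = 0 → h = 0) {r : Lam} (hr0 : r ≠ 0) (hr : ∀ h : H, r • h = 0) :
    ∃ (n : ℕ) (B : Matrix (Fin n) (Fin n) Lam), Represents B lam := by
  obtain ⟨m, y, e, h, -⟩ := exists_diagGen_primary hl htau hr0 hr
  exact ⟨m, _, h.represents hl⟩

theorem odd_sgn {x : ℝ} (h : x ≠ 0) : Odd (sgn x) := by
  rcases lt_or_gt_of_ne h with h | h
  · rw [sgn_of_neg h]; decide
  · rw [sgn_of_pos h]; decide

/-- Parity: together with `odd_sgn` at 2 it makes η ± σ even, so that μ is an integer. -/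
theorem odd_zer_add_sgn (x : ℝ) : Odd (zer x + sgn x) := by
  by_cases h : x = 0
  · rw [h, zer_zero, sgn_zero]; decide
  · rw [zer_of_ne h, zero_add]; exact odd_sgn h

theorem IsPrimary.eval_two_ne_zero {d : Polynomial ℝ} (h : IsPrimary d) : d.eval 2 ≠ 0 := by
  rcases h with ⟨ε, c, k, hε, hc, -, rfl⟩ | ⟨-, h⟩
  · simp only [Polynomial.eval_mul, Polynomial.eval_C, Polynomial.eval_pow, Polynomial.eval_sub,
      Polynomial.eval_X]
    exact mul_ne_zero hε (pow_ne_zero _ (sub_ne_zero.2 hc.2.ne'))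
  · exact (h 2 (by norm_num)).ne'

/-- The minimal size of a matrix which represents a form without `(t² - 1)`-torsion. -/
theorem IsNondeg.nR_eq (hl : IsNondeg lam) [Module.Finite Lam H]
    (htau : ∀ h : H, tau • h = 0 → h = 0) {r : Lam} (hr0 : r ≠ 0) (hr : ∀ h : H, r • h = 0)
    {n : ℕ} {B : Matrix (Fin n) (Fin n) Lam} (hB : Represents B lam) :
    ∃ N : ℕ, nR lam = N ∧ (N : ℚ) = max (muMat B) (etaMat B : ℚ) := by
  obtain ⟨m, y, e, hD, he⟩ := exists_diagGen_primary hl htau hr0 hr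
  have heven : ∀ w, Even ((nul B (Circle.toUnits w) : ℤ) + sig B w) := fun w => by
    rw [hD.nul_eq_sum hl hB, hD.sig_eq_sum hl hB, ← Finset.sum_add_distrib]
    refine Finset.even_sum _ fun k _ => ?_
    rw [← add_sub_assoc]
    exact (odd_zer_add_sgn _).sub_odd (odd_sgn (he k).eval_two_ne_zero)
  have heven' : ∀ w, Even ((nul B (Circle.toUnits w) : ℤ) - sig B w) := fun w => by
    have := heven w
    rw [Int.even_add] at this
    rwa [Int.even_sub]
  have hBh := hB.1
  have hbdd1 : BddAbove (Set.range fun w : Circle =>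
      ((nul B (Circle.toUnits w) : ℤ) + sig B w)) :=
    ⟨_, by rintro _ ⟨w, rfl⟩; exact nul_add_sig_le hBh w⟩
  have hbdd2 : BddAbove (Set.range fun w : Circle =>
      ((nul B (Circle.toUnits w) : ℤ) - sig B w)) :=
    ⟨_, by rintro _ ⟨w, rfl⟩; exact nul_sub_sig_le hBh w⟩
  set a : ℤ := ⨆ w : Circle, ((nul B (Circle.toUnits w) : ℤ) + sig B w) with ha
  set b : ℤ := ⨆ w : Circle, ((nul B (Circle.toUnits w) : ℤ) - sig B w) with hb
  have hle1 : ∀ w : Circle, (nul B (Circle.toUnits w) : ℤ) + sig B w ≤ a := fun w =>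
    le_ciSup hbdd1 w
  have hle2 : ∀ w : Circle, (nul B (Circle.toUnits w) : ℤ) - sig B w ≤ b := fun w =>
    le_ciSup hbdd2 w
  have haev : Even a := by
    obtain ⟨w, hw⟩ := Int.csSup_mem (Set.range_nonempty _) hbdd1
    rw [ha, iSup, ← hw]
    exact heven w
  have hbev : Even b := by
    obtain ⟨w, hw⟩ := Int.csSup_mem (Set.range_nonempty _) hbdd2
    rw [hb, iSup, ← hw]
    exact heven' w
  have hsig1 : sig B 1 = 0 := by rw [sig, map_one, sub_self]
  have ha0 : 0 ≤ a := by have := hle1 1; omega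
  have hb0 : 0 ≤ b := by have := hle2 1; omega
  -- With maxima 2q and 2p the value of μ is p + q: the sweep uses q negative slots and at least p
  -- positive ones.
  obtain ⟨q, hq⟩ : ∃ q : ℕ, a = 2 * q := by
    obtain ⟨s, hs⟩ := haev
    exact ⟨s.toNat, by omega⟩
  obtain ⟨p, hp⟩ : ∃ p : ℕ, b = 2 * p := by
    obtain ⟨s, hs⟩ := hbev
    exact ⟨s.toNat, by omega⟩
  have hmu : muMat B = ((p + q : ℕ) : ℚ) := by
    rw [muMat, ← ha, ← hb, hq, hp]
    push_cast
    ring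
  have hN : ((max (p + q) (etaMat B) : ℕ) : ℚ) = max (muMat B) (etaMat B : ℚ) := by
    rw [hmu, Nat.cast_max]
  refine ⟨max (p + q) (etaMat B), le_antisymm ?_ ?_, hN⟩
  · have hpq : p + q ≤ max (p + q) (etaMat B) := le_max_left _ _
    obtain ⟨z, d, hzd⟩ := (Sweep.initial (N := max (p + q) (etaMat B)) (q := q) hD he
      (by omega)).exists_diagGen hl hB
      (fun w => (le_ciSup (bddAbove_nul B) w).trans (le_max_right _ _))
      (fun w => by rw [← hq]; exact hle1 w)
      -- Here 2p ≤ 2(N - q), because N is at least p + q.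
      (fun w => (hle2 w).trans (by
        rw [hp]
        have : ((p + q : ℕ) : ℤ) ≤ (max (p + q) (etaMat B) : ℕ) := by exact_mod_cast hpq
        push_cast at this ⊢
        omega))
    refine sInf_le ⟨_, _, rfl, hzd.represents hl, 1, by simp, ?_⟩
    rw [evalOne, diagonal_map (map_zero _), one_mul, transpose_one, mul_one]
    exact isDiag_diagonal _
  · refine le_sInf ?_
    rintro _ ⟨n', A, rfl, hA, -⟩
    have h := max_muMat_etaMat_le hA.1
    rw [muMat_eq_of_represents hA hB, etaMat_eq_of_represents hA hB, ← hN] at h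
    exact_mod_cast h

theorem tau_eq : tau = LaurentPolynomial.T (-1) *
    ((LaurentPolynomial.T 1 + 1) * (LaurentPolynomial.T 1 - 1)) := by
  have hT : (LaurentPolynomial.T 1 * LaurentPolynomial.T (-1) : Lam) = 1 := by
    rw [← LaurentPolynomial.T_add]; simp
  rw [tau]
  linear_combination - LaurentPolynomial.T 1 * hT

theorem tau_mul_tau : tau * tau = ofPoly ((Polynomial.X - Polynomial.C 2) *
    (Polynomial.X - Polynomial.C (-2))) := by
  have hT : (LaurentPolynomial.T 1 * LaurentPolynomial.T (-1) : Lam) = 1 := by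
    rw [← LaurentPolynomial.T_add]; simp
  have h2 : (LaurentPolynomial.C 2 : Lam) = 2 := map_ofNat _ _
  rw [map_mul, map_sub, map_sub, ofPoly_X, ofPoly_C, ofPoly_C, tau, map_neg, h2]
  linear_combination - 4 * hT

theorem eq_zero_of_tau_smul (h1 : Function.Injective
      (fun h : H => (LaurentPolynomial.T 1 + 1 : Lam) • h))
    (h2 : Function.Injective (fun h : H => (LaurentPolynomial.T 1 - 1 : Lam) • h)) (h : H)
    (hh : tau • h = 0) : h = 0 := by
  have e : (LaurentPolynomial.T 1 + 1 : Lam) • (LaurentPolynomial.T 1 - 1 : Lam) • h = 0 := by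
    have := congrArg (fun x => (LaurentPolynomial.T 1 : Lam) • x) hh
    rw [smul_zero, tau_eq, smul_smul, ← mul_assoc, ← LaurentPolynomial.T_add] at this
    simpa [mul_smul] using this
  refine h2 ((h1 ?_).trans (smul_zero _).symm)
  exact e.trans (smul_zero _).symm

theorem det_smul_coker {n : ℕ} (B : Matrix (Fin n) (Fin n) Lam) (h : Coker B) : B.det • h = 0 := by
  obtain ⟨v, rfl⟩ := Submodule.Quotient.mk_surjective _ h
  rw [← Submodule.Quotient.mk_smul, Submodule.Quotient.mk_eq_zero]
  refine ⟨B.adjugate *ᵥ v, ?_⟩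
  rw [mulVecLin_apply, mulVec_mulVec, mul_adjugate, smul_mulVec, one_mulVec]

theorem ev_det {n : ℕ} (B : Matrix (Fin n) (Fin n) Lam) (w : ℂˣ) :
    ev w B.det = (evalAt B w).det := by
  rw [RingHom.map_det]
  rfl

/-- The cokernel is killed by the norm of det B, a polynomial in X that is non-zero at ±2 and hence
coprime to τ² = (X - 2)(X + 2). -/
theorem eq_zero_of_tau_smul_coker {n : ℕ} {B : Matrix (Fin n) (Fin n) Lam}
    (h1 : (evalAt B 1).det ≠ 0) (h2 : (evalAt B (-1)).det ≠ 0) (h : Coker B)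
    (hh : tau • h = 0) : h = 0 := by
  obtain ⟨f, hf⟩ := exists_ofPoly_eq (p := B.det * conj B.det) (by
    rw [map_mul, conj_conj, mul_comm])
  have hne : ∀ z : Circle, (evalAt B (Circle.toUnits z)).det ≠ 0 →
      f.eval (2 * (z : ℂ).re) ≠ 0 := by
    intro z hz h0
    have h3 := ev_circle_ofPoly z f
    rw [hf, h0, map_mul, ev_conj, ev_det, Complex.ofReal_zero] at h3
    exact (mul_ne_zero hz (star_ne_zero.2 hz)) h3
  have hf1 : f.eval 2 ≠ 0 := by
    have := hne 1 (by rwa [map_one])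
    simpa using this
  have hf2 : f.eval (-2) ≠ 0 := by
    have hu : Circle.toUnits (-1) = -1 := by ext; simp [Circle.toUnits_apply]
    have := hne (-1) (by rwa [hu])
    simpa using this
  have hcop : ∀ c : ℝ, f.eval c ≠ 0 → IsCoprime (Polynomial.X - Polynomial.C c) f := fun c hc =>
    ((Polynomial.irreducible_X_sub_C c).coprime_iff_not_dvd).2 fun h0 =>
      hc (Polynomial.dvd_iff_isRoot.1 h0)
  obtain ⟨a, b, hab⟩ := isCoprime_ofPoly ((hcop 2 hf1).mul_left (hcop (-2) hf2))
  rw [← one_smul Lam h, ← hab, ← tau_mul_tau, hf, add_smul, mul_smul a, mul_smul tau, hh,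
    mul_comm B.det, mul_smul b, mul_smul (conj B.det), det_smul_coker]
  simp

end Main

end

end Blanchfield

theorem theorem2p6 :
    (∀ (H : Type*) [AddCommGroup H] [Module Blanchfield.Lam H] (lam : Blanchfield.Form H),
      Blanchfield.IsBlanchfield lam →
      Function.Bijective (fun h : H => (LaurentPolynomial.T 1 + 1 : Blanchfield.Lam) • h) →
      Function.Bijective (fun h : H => (LaurentPolynomial.T 1 - 1 : Blanchfield.Lam) • h) →
      (∃ (n : ℕ) (B : Matrix (Fin n) (Fin n) Blanchfield.Lam), Blanchfield.Represents B lam) ∧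
      (∀ (n : ℕ) (B : Matrix (Fin n) (Fin n) Blanchfield.Lam), Blanchfield.Represents B lam →
        Blanchfield.muMat B = Blanchfield.mu lam ∧ Blanchfield.etaMat B = Blanchfield.eta lam) ∧
      ∃ N : ℕ, Blanchfield.nR lam = N ∧
        (N : ℚ) = max (Blanchfield.mu lam) (Blanchfield.eta lam : ℚ)) ∧
    (∀ (n : ℕ) (B : Matrix (Fin n) (Fin n) Blanchfield.Lam) (hB : Blanchfield.IsHerm B)
      (h1 : (Blanchfield.evalAt B 1).det ≠ 0) (_ : (Blanchfield.evalAt B (-1)).det ≠ 0),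
      ∃ N : ℕ,
        Blanchfield.nR (Blanchfield.formOf B hB
          (Blanchfield.det_ne_zero_of_det_evalAt_ne_zero h1)) = N ∧
        (N : ℚ) = max (Blanchfield.muMat B) (Blanchfield.etaMat B : ℚ)) := by
  constructor
  · intro H _ _ lam hlam h1 h2
    have hl := hlam.isNondeg
    have htau := Blanchfield.eq_zero_of_tau_smul h1.1 h2.1
    have := hlam.finite
    obtain ⟨r, hr, hr0⟩ := Submodule.annihilator_top_inter_nonZeroDivisors hlam.torsion
    have hr0 : r ≠ 0 := nonZeroDivisors.ne_zero hr0
    have hr : ∀ h : H, r • h = 0 := fun h => Submodule.mem_annihilator.1 hr h Submodule.mem_top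
    obtain ⟨n, B, hB⟩ := hl.exists_represents htau hr0 hr
    refine ⟨⟨n, B, hB⟩, fun n B hB => ⟨hB.muMat_eq, hB.etaMat_eq⟩, ?_⟩
    rw [← hB.muMat_eq, ← hB.etaMat_eq]
    exact hl.nR_eq htau hr0 hr hB
  · intro n B hB h1 h2
    have hd := Blanchfield.det_ne_zero_of_det_evalAt_ne_zero h1
    refine (Blanchfield.isNondeg_formOf hB hd).nR_eq
      (Blanchfield.eq_zero_of_tau_smul_coker h1 h2) hd (Blanchfield.det_smul_coker B)
      ⟨hB, hd, LinearEquiv.refl _ _, fun a b => rfl⟩
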